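/- Let $\mathcal M$ be a finite Markov decision process with finite state space $\mathcal S$ ($S=|\mathcal S|$), finite non-empty action space $\mathcal A$ ($A=|\mathcal A|$), transition probabilities $p(s'|s,a)$, rewards $r(s,a)\in[0,1]$, discount factor $\gamma\in[0,1)$ and an initial distribution $\rho$ with $\rho(s)>0$ for all $s$. For $\theta\in\mathbf R^{SA}$ let $\pi_\theta(a|s)=\exp(\theta_{s,a})/\sum_{a'}\exp(\theta_{s,a'})$, $F(\pi)=\mathbf E\sum_{t\ge0}\gamma^t r(s_t,a_t)$ (with $s_0\sim\rho$, $a_t\sim\pi(\cdot|s_t)$, $s_{t+1}\sim p(\cdot|s_t,a_t)$), $R(\theta)=\frac1{SA}\sum_{s,a}\log\pi_\theta(a|s)$ and $L_\lambda(\theta)=F(\pi_\theta)+\lambda R(\theta)$. For a baseline $b:\mathcal S\to\mathbf R$, $\beta\in(0,1)$, $\lambda\ge 0$, a horizon $H$ and a trajectory $\tau=(s_0,a_0,\dots,s_H,a_H)$ define the REINFORCE estimator $$\widehat g_{\lambda,\theta,H}(\tau)=\sum_{t=0}^{\lfloor\beta H\rfloor}\gamma^t\Big(\sum_{t'=t}^{H}\gamma^{t'-t}r(s_{t'},a_{t'})-b(s_t)\Big)\nabla_\theta\log\pi_\theta(a_t|s_t)+\frac{\lambda}{SA}\sum_{s,a}\nabla_\theta\log\pi_\theta(a|s).$$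 Consider the phased policy gradient method with phase lengths $T_l\ge1$, step sizes $\alpha^{l,k}$ and regularization parameters $\lambda^l\geq 0$ ($l\ge0$, $0\le k<T_l$): given the iterate $\theta^{l,k}$ one chooses a (possibly random) horizon $H^{l,k}$ before sampling, samples a trajectory $\tau^{l,k}$ of length $H^{l,k}$ following $\pi_{\theta^{l,k}}$ which, given $\theta^{l,k}$ and $H^{l,k}$, is conditionally independent of all previous iterates, horizons and trajectories, and sets $\theta^{l,k+1}=\theta^{l,k}+\alpha^{l,k}\widehat g^{l,k}$ with $\widehat g^{l,k}=\widehat g_{\lambda^l,\theta^{l,k},H^{l,k}}(\tau^{l,k})$; the initial parameter and the last iterate of each phase are post-processed by a map whose values $\theta'$ satisfy $\pi_{\theta'}(a|s)\ge\epsilon_{\rm pp}$ for all $s,a$, where $\epsilon_{\rm pp}\in(0,1/A]$ is fixed, and the result is the first iterate $\theta^{0,0}$, respectively $\theta^{l+1,0}$. Let $\mathbf E_{l,k}$ be the conditional expectation given $\theta^{l,k}$. Suppose that $\lambda^l\le\bar\lambda$ for all $l$, that $|b(s)|\le B$ for all $s$, with a constant $B>0$, and that for all $l$ and $0\le k<T_l$,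 almost surely, $$H^{l,k}\ \ge\ \frac{2\log_{1/\gamma}\big(8(k+1)/(1-\gamma)^3\big)}{3\min\{\beta,1-\beta\}}$$ (for $\gamma=0$, $\log_{1/\gamma}$ is read as $0$). For a random vector $X$ let $\mathbf{Var}\,X$ be the sum of the variances of its coordinates and put $$\bar V_b=\sup_{H\ge0,\ \theta\in\mathbf R^{SA},\ \lambda\in[0,\bar\lambda]}\mathbf{Var}\,\widehat g_{\lambda,\theta,H}(\tau),\qquad \tau\text{ sampled with horizon }H\text{ following }\pi_\theta .$$ Then this supremum is finite, with $$\bar V_b\in\Big[0,\,4\Big(\tfrac{1+B(1-\gamma)}{(1-\gamma)^2}+\bar\lambda\Big)^2\Big],$$ and with $$C=16\Big(\tfrac1{(1-\gamma)^2}+\bar\lambda\Big)^2,\quad C_1=\tfrac{2(1+B(1-\gamma))}{(1-\gamma)^2}+2\bar\lambda,\quad C_2=1,\quad M_1=\tfrac{32}{(1-\gamma)^4}+\bar V_b,\quad M_2=2,$$ $$\delta_{l,k}=\Big(\tfrac{2}{(1-\gamma)^2}+2\bar\lambda\Big)(k+1)^{-2/3},$$ all five constants are positive, each $L_{\lambda^l}$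 is differentiable, $\widehat g^{l,k}$ and $\|\widehat g^{l,k}\|_2^2$ are integrable, and for all $l\ge0$ and $0\le k<T_l$, almost surely, $$\|\widehat g^{l,k}\|_2\le C_1,$$ $$\nabla L_{\lambda^l}(\theta^{l,k})^T\,\mathbf E_{l,k}\widehat g^{l,k}\ \ge\ C_2\|\nabla L_{\lambda^l}(\theta^{l,k})\|_2^2-\delta_{l,k},$$ $$\mathbf E_{l,k}\|\widehat g^{l,k}\|_2^2\ \le\ M_1+M_2\|\nabla L_{\lambda^l}(\theta^{l,k})\|_2^2,$$ $$H^{l,k}\ge\log_{1/\gamma}(k+1),$$ and $\sum_{k=0}^{T_l-1}\delta_{l,k}^2\le C$ for every $l\ge0$. -/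

import Mathlib

open MeasureTheory ProbabilityTheory

noncomputable section

/-- A finite discounted Markov decision process with state space `S` and action space `A`:
transition probabilities `p(·|s,a)`, rewards in `[0,1]`, discount factor in `[0,1)` and an initial
state distribution that charges every state. -/
structure FiniteMDP (S A : Type*) where
  trans : S → A → PMF S
  reward : S → A → ℝ
  reward_nonneg : ∀ s a, 0 ≤ reward s a
  reward_le_one : ∀ s a, reward s a ≤ 1
  discount : ℝ
  discount_nonneg : 0 ≤ discount
  discount_lt_one : discount < 1
  initial : PMF S
  initial_pos : ∀ s, initial s ≠ 0

/-- The parameter space `ℝ^{SA}` with its Euclidean norm. -/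
abbrev PolicyParam (S A : Type*) : Type _ := EuclideanSpace ℝ (S × A)

section Softmax

variable {S A : Type*} [Fintype A]

/-- `π_θ(s,a) = exp θ_{s,a} / ∑_{a'} exp θ_{s,a'}`. -/
def softmaxProb (θ : PolicyParam S A) (s : S) (a : A) : ℝ :=
  Real.exp (θ (s, a)) / ∑ a', Real.exp (θ (s, a'))

theorem softmaxProb_nonneg (θ : PolicyParam S A) (s : S) (a : A) : 0 ≤ softmaxProb θ s a :=
  div_nonneg (Real.exp_pos _).le (Finset.sum_nonneg fun _ _ => (Real.exp_pos _).le)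

theorem sum_softmaxProb [Nonempty A] (θ : PolicyParam S A) (s : S) :
    ∑ a, softmaxProb θ s a = 1 := by
  have h : 0 < ∑ a', Real.exp (θ (s, a')) :=
    Finset.sum_pos (fun _ _ => Real.exp_pos _) Finset.univ_nonempty
  simp only [softmaxProb]
  rw [← Finset.sum_div, div_self h.ne']

/-- The soft-max policy as a map into probability distributions on actions. -/
def softmaxPolicy [Nonempty A] (θ : PolicyParam S A) (s : S) : PMF A :=
  PMF.ofFintype (fun a => ENNReal.ofReal (softmaxProb θ s a)) (by
    rw [← ENNReal.ofReal_sum_of_nonneg fun a _ => softmaxProb_nonneg θ s a, sum_softmaxProb,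
      ENNReal.ofReal_one])

/-- The score `∇_θ log π_θ(a|s)`. -/
def score [Fintype S] (θ : PolicyParam S A) (s : S) (a : A) : PolicyParam S A :=
  gradient (fun θ' : PolicyParam S A => Real.log (softmaxProb θ' s a)) θ

/-- The log-barrier `R(θ) = (1/(SA)) ∑_{s,a} log π_θ(s,a)`. -/
def logBarrier [Fintype S] (θ : PolicyParam S A) : ℝ :=
  1 / ((Fintype.card S : ℝ) * (Fintype.card A : ℝ)) * ∑ s, ∑ a, Real.log (softmaxProb θ s a)

end Softmax

namespace FiniteMDP

section Law

variable {S A : Type*} [MeasurableSpace S] [MeasurableSpace A]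

/-- The joint law of a state drawn from `q` and an action drawn from the policy at that state. -/
def stateActionPMF (q : PMF S) (π : S → PMF A) : PMF (S × A) :=
  q.bind fun s => (π s).map fun a => (s, a)

variable [DiscreteMeasurableSpace S] [DiscreteMeasurableSpace A]

/-- Given the state-action pairs up to time `n`, the pair at time `n + 1` is obtained by drawing
`s_{n+1} ∼ p(·|s_n,a_n)` and then `a_{n+1} ∼ π(·|s_{n+1})`. -/
def stepKernel [Finite S] [Finite A] (M : FiniteMDP S A) (π : S → PMF A) (n : ℕ) :
    Kernel (∀ _ : Finset.Iic n, S × A) (S × A) :=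
  Kernel.ofFunOfCountable fun h =>
    (stateActionPMF (M.trans (h ⟨n, Finset.mem_Iic.2 le_rfl⟩).1
      (h ⟨n, Finset.mem_Iic.2 le_rfl⟩).2) π).toMeasure

instance [Finite S] [Finite A] (M : FiniteMDP S A) (π : S → PMF A) (n : ℕ) :
    IsMarkovKernel (M.stepKernel π n) :=
  ⟨fun _ => PMF.toMeasure.isProbabilityMeasure _⟩

/-- The law of the infinite trajectory `(s_t, a_t)_{t ≥ 0}` under the policy `π`, started from
`s_0 ∼ ρ`. -/
def trajLaw [Finite S] [Finite A] (M : FiniteMDP S A) (π : S → PMF A) : Measure (ℕ → S × A) :=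
  Kernel.trajMeasure (X := fun _ => S × A) (stateActionPMF M.initial π).toMeasure (M.stepKernel π)

/-- The expected cumulative discounted reward `F(π)`. -/
def value [Finite S] [Finite A] (M : FiniteMDP S A) (π : S → PMF A) : ℝ :=
  ∫ x, ∑' t : ℕ, M.discount ^ t * M.reward (x t).1 (x t).2 ∂(M.trajLaw π)

end Law

section Estimator

variable {S A : Type*} [Fintype S] [Fintype A]

/-- `Q̂(s_t,a_t) = ∑_{t'=t}^{H} γ^{t'-t} r(s_{t'},a_{t'})` along the trajectory `x`. -/
def qHat (M : FiniteMDP S A) (H : ℕ) (x : ℕ → S × A) (t : ℕ) : ℝ :=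
  ∑ t' ∈ Finset.Icc t H, M.discount ^ (t' - t) * M.reward (x t').1 (x t').2

/-- The REINFORCE estimator with baseline `b`, log-barrier weight `lam` and horizon `H`. It only
reads the coordinates `0, …, H` of `x`. -/
def reinforce (M : FiniteMDP S A) (β : ℝ) (b : S → ℝ) (lam : ℝ) (θ : PolicyParam S A) (H : ℕ)
    (x : ℕ → S × A) : PolicyParam S A :=
  ∑ t ∈ Finset.range (⌊β * (H : ℝ)⌋₊ + 1),
      (M.discount ^ t * (M.qHat H x t - b (x t).1)) • score θ (x t).1 (x t).2
    + (lam / ((Fintype.card S : ℝ) * (Fintype.card A : ℝ))) • ∑ s, ∑ a, score θ s a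

variable [Nonempty A] [MeasurableSpace S] [MeasurableSpace A] [DiscreteMeasurableSpace S]
  [DiscreteMeasurableSpace A]

/-- The regularized objective `L_λ(θ) = F(π_θ) + λ R(θ)`. -/
def surrogate (M : FiniteMDP S A) (lam : ℝ) (θ : PolicyParam S A) : ℝ :=
  M.value (softmaxPolicy θ) + lam * logBarrier θ

/-- The total variance (sum of the coordinate variances) of the REINFORCE estimator when the
trajectory of length `H` is sampled following `π_θ`. -/
def reinforceVar (M : FiniteMDP S A) (β : ℝ) (b : S → ℝ) (lam : ℝ) (θ : PolicyParam S A)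
    (H : ℕ) : ℝ :=
  ∑ i, variance (fun x => M.reinforce β b lam θ H x i) (M.trajLaw (softmaxPolicy θ))

/-- All variances of REINFORCE estimators with horizon `H ≥ 0`, parameter `θ` and
`λ ∈ [0, lamBar]`. -/
def reinforceVarSet (M : FiniteMDP S A) (β : ℝ) (b : S → ℝ) (lamBar : ℝ) : Set ℝ :=
  {v | ∃ (H : ℕ) (θ : PolicyParam S A) (lam : ℝ), lam ∈ Set.Icc 0 lamBar ∧
    v = M.reinforceVar β b lam θ H}

/-- The uniform upper bound `V̄_b` on the variances. -/
def reinforceVarBound (M : FiniteMDP S A) (β : ℝ) (b : S → ℝ) (lamBar : ℝ) : ℝ :=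
  sSup (M.reinforceVarSet β b lamBar)

end Estimator

end FiniteMDP

/-- The path `x` frozen after time `n`; it carries exactly the information `x_0, …, x_n`. -/
def stopPath {X : Type*} (n : ℕ) (x : ℕ → X) : ℕ → X := fun i => x (min i n)

section Algorithm

variable {S A Ω : Type*} [Fintype S] [Fintype A] [MeasurableSpace S] [MeasurableSpace A]

/-- What is known immediately before the `(l,k)`-th trajectory is sampled: all earlier iterates,
horizons and (truncated) trajectories, together with the current iterate and horizon. -/
abbrev history (T : ℕ → ℕ) (θ : ℕ → ℕ → Ω → PolicyParam S A) (H : ℕ → ℕ → Ω → ℕ)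
    (τ : ℕ → ℕ → Ω → ℕ → S × A) (l k : ℕ) : MeasurableSpace Ω :=
  (⨆ (l' : ℕ) (k' : ℕ) (_ : k' < T l' ∧ (l' < l ∨ (l' = l ∧ k' < k))),
      MeasurableSpace.comap (θ l' k') inferInstance ⊔
      MeasurableSpace.comap (H l' k') inferInstance ⊔
      MeasurableSpace.comap (fun ω => stopPath (H l' k' ω) (τ l' k' ω)) inferInstance) ⊔
    MeasurableSpace.comap (θ l k) inferInstance ⊔
    MeasurableSpace.comap (H l k) inferInstance

variable [Nonempty A] [DiscreteMeasurableSpace S] [DiscreteMeasurableSpace A]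

/-- A run of the phased policy gradient method with step sizes `α`, phase lengths `T`,
post-processing map `post` with tolerance `ε` and stochastic gradients `g`. In episode `k < T l` of
phase `l` the iterate is `θ l k`, the horizon `H l k` is chosen before sampling, and the sampled
trajectory consists of the entries `0, …, H l k` of `τ l k`; later entries are irrelevant. -/
structure IsPhasedPolicyGradient [MeasurableSpace Ω] (M : FiniteMDP S A) (μ : Measure Ω)
    (α : ℕ → ℕ → ℝ) (T : ℕ → ℕ) (ε : ℝ) (post : PolicyParam S A → PolicyParam S A)
    (g θ : ℕ → ℕ → Ω → PolicyParam S A) (H : ℕ → ℕ → Ω → ℕ)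
    (τ : ℕ → ℕ → Ω → ℕ → S × A) : Prop where
  measurable_param : ∀ l k, Measurable (θ l k)
  measurable_horizon : ∀ l k, Measurable (H l k)
  measurable_traj : ∀ l k, Measurable (τ l k)
  tolerance_pos : 0 < ε
  tolerance_le : ε ≤ 1 / (Fintype.card A : ℝ)
  le_post : ∀ η s a, ε ≤ softmaxProb (post η) s a
  init : ∃ θinit : Ω → PolicyParam S A, ∀ ω, θ 0 0 ω = post (θinit ω)
  step : ∀ l k, k < T l → ∀ ω, θ l (k + 1) ω = θ l k ω + α l k • g l k ω
  phase : ∀ l ω, θ (l + 1) 0 ω = post (θ l (T l) ω)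
  /-- Given the history, the trajectory is sampled from the process following `π_{θ^{l,k}}`, and
  therefore depends on the past only through the current policy. -/
  law : ∀ l k, k < T l → ∀ E : Set (ℕ → S × A), MeasurableSet E →
    μ⟦{ω | stopPath (H l k ω) (τ l k ω) ∈ E} | history T θ H τ l k⟧ =ᵐ[μ]
      fun ω => (M.trajLaw (softmaxPolicy (θ l k ω))).real {x | stopPath (H l k ω) x ∈ E}

/-- The conditions on a policy gradient estimator, with explicit constants. The expectation
`𝐄_{l,k}` is the conditional expectation given the iterate `θ l k`. The differentiability and
integrability clauses make sure that all gradients and conditional expectations are genuine. -/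
structure PolicyGradientEstimatorCondition [MeasurableSpace Ω] (M : FiniteMDP S A) (μ : Measure Ω)
    (lam : ℕ → ℝ) (T : ℕ → ℕ) (g θ : ℕ → ℕ → Ω → PolicyParam S A) (H : ℕ → ℕ → Ω → ℕ)
    (C C₁ C₂ M₁ M₂ : ℝ) (δ : ℕ → ℕ → ℝ) : Prop where
  pos_C : 0 < C
  pos_C₁ : 0 < C₁
  pos_C₂ : 0 < C₂
  pos_M₁ : 0 < M₁
  pos_M₂ : 0 < M₂
  differentiable : ∀ l, Differentiable ℝ (M.surrogate (lam l))
  integrable : ∀ l k, k < T l → Integrable (g l k) μ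
  integrable_sq : ∀ l k, k < T l → Integrable (fun ω => ‖g l k ω‖ ^ 2) μ
  bounded : ∀ l k, k < T l → ∀ᵐ ω ∂μ, ‖g l k ω‖ ≤ C₁
  nearly_unbiased : ∀ l k, k < T l → ∀ᵐ ω ∂μ,
    C₂ * ‖gradient (M.surrogate (lam l)) (θ l k ω)‖ ^ 2 - δ l k ≤
      inner ℝ (gradient (M.surrogate (lam l)) (θ l k ω))
        ((μ[g l k | MeasurableSpace.comap (θ l k) inferInstance]) ω)
  second_moment : ∀ l k, k < T l → ∀ᵐ ω ∂μ,
    (μ[fun ω' => ‖g l k ω'‖ ^ 2 | MeasurableSpace.comap (θ l k) inferInstance]) ω ≤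
      M₁ + M₂ * ‖gradient (M.surrogate (lam l)) (θ l k ω)‖ ^ 2
  sum_sq_bias : ∀ l, ∑ k ∈ Finset.range (T l), δ l k ^ 2 ≤ C
  horizon : ∀ l k, k < T l → ∀ᵐ ω ∂μ,
    Real.logb (1 / M.discount) ((k : ℝ) + 1) ≤ (H l k ω : ℝ)

end Algorithm

end

/-! The mean of the REINFORCE estimator is, up to the exact regularizer gradient, a partial sum of
an absolutely convergent double series whose full sum is the policy gradient. All the conditions
reduce to a bound on the missing tail.

The probability of a finite path is a factor free of the policy times the product of the action
probabilities (`trajLaw_real_cylinder`). Differentiating the expected reward at time n therefore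
produces the scores of the actions at times i ≤ n. Summing over n, and indexing by action time t and
delay d, writes the gradient as a series with terms of norm at most 2γ^(t+d)
(`hasGradientAt_value`). Baselines drop out because scores have mean zero under the policy, so the
estimator keeps exactly the pairs with t ≤ ⌊βH⌋ and t + d ≤ H (`integral_reinforce`). For the
remaining pairs t > ⌊βH⌋ or d > H - ⌊βH⌋. The logarithmic lower bound on H makes this tail at most
(k+1)^(-2/3) (`norm_gradient_sub_integral_reinforce_le_rpow`).

Near-unbiasedness then follows by Cauchy–Schwarz and a uniform gradient bound. The second moment
follows from E‖g‖² = Var + ‖E g‖². The squared biases are summable because ∑ (k+1)^(-4/3) ≤ 4.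

To pass to the algorithm, conditioning on the history freezes parameter and horizon
(`condExp_history_ae_eq`). The bounds hold for every admissible horizon, so they survive averaging
over H given θ alone. -/

/-! ### Softmax scores and the log-barrier gradient. -/

section SoftmaxCalculus

variable {S A : Type*} [Fintype A]

theorem sum_exp_pos [Nonempty A] (θ : PolicyParam S A) (s : S) :
    0 < ∑ a', Real.exp (θ (s, a')) :=
  Finset.sum_pos (fun _ _ => Real.exp_pos _) Finset.univ_nonempty

theorem softmaxProb_pos [Nonempty A] (θ : PolicyParam S A) (s : S) (a : A) :
    0 < softmaxProb θ s a :=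
  div_pos (Real.exp_pos _) (sum_exp_pos θ s)

theorem log_softmaxProb [Nonempty A] (θ : PolicyParam S A) (s : S) (a : A) :
    Real.log (softmaxProb θ s a) = θ (s, a) - Real.log (∑ a', Real.exp (θ (s, a'))) := by
  rw [softmaxProb, Real.log_div (Real.exp_pos _).ne' (sum_exp_pos θ s).ne', Real.log_exp]

theorem softmaxPolicy_toReal [Nonempty A] (θ : PolicyParam S A) (s : S) (a : A) :
    (softmaxPolicy θ s a).toReal = softmaxProb θ s a := by
  simp [softmaxPolicy, ENNReal.toReal_ofReal (softmaxProb_nonneg θ s a)]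

variable [Fintype S]

theorem differentiable_log_softmaxProb [Nonempty A] (s : S) (a : A) :
    Differentiable ℝ (fun θ : PolicyParam S A => Real.log (softmaxProb θ s a)) := by
  simp only [log_softmaxProb]
  have h : ∀ θ : PolicyParam S A, ∑ a', Real.exp (θ (s, a')) ≠ 0 := fun θ => (sum_exp_pos θ s).ne'
  fun_prop (disch := assumption)

theorem hasGradientAt_log_softmaxProb [Nonempty A] (θ : PolicyParam S A) (s : S) (a : A) :
    HasGradientAt (fun θ' : PolicyParam S A => Real.log (softmaxProb θ' s a)) (score θ s a) θ :=
  (differentiable_log_softmaxProb s a θ).hasGradientAt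

theorem score_eq [Nonempty A] [DecidableEq S] [DecidableEq A] (θ : PolicyParam S A)
    (s : S) (a : A) :
    score θ s a = EuclideanSpace.single (s, a) (1 : ℝ) -
      ∑ a', softmaxProb θ s a' • EuclideanSpace.single (s, a') (1 : ℝ) := by
  refine (hasGradientAt_log_softmaxProb θ s a).unique ?_
  rw [hasGradientAt_iff_hasFDerivAt]
  simp only [log_softmaxProb]
  have hc : ∀ i : S × A, HasFDerivAt (fun θ' : PolicyParam S A => θ' i)
      (EuclideanSpace.proj i : PolicyParam S A →L[ℝ] ℝ) θ := fun i =>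
    (EuclideanSpace.proj i : PolicyParam S A →L[ℝ] ℝ).hasFDerivAt
  have h := (hc (s, a)).sub ((HasFDerivAt.fun_sum (u := Finset.univ)
    fun a' _ => (hc (s, a')).exp).log (sum_exp_pos θ s).ne')
  refine h.congr_fderiv ?_
  ext v
  simp [softmaxProb, Finset.mul_sum, div_eq_inv_mul,
    mul_assoc, EuclideanSpace.inner_single_left]

theorem norm_score_le [Nonempty A] (θ : PolicyParam S A) (s : S) (a : A) :
    ‖score θ s a‖ ≤ 2 := by
  classical
  rw [score_eq]
  have h : ‖∑ a', softmaxProb θ s a' • (EuclideanSpace.single (s, a') (1 : ℝ) :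
      PolicyParam S A)‖ ≤ 1 := by
    refine (norm_sum_le_of_le (n := fun a' => softmaxProb θ s a') _ fun a' _ => ?_).trans_eq
      (sum_softmaxProb θ s)
    simp [norm_smul, abs_of_nonneg (softmaxProb_nonneg θ s a')]
  refine (norm_sub_le _ _).trans ?_
  rw [PiLp.norm_single, norm_one]
  linarith

/-- The subtracted part of the score is the policy average of the first part. This cancellation is
what makes baselines harmless. -/
theorem sum_softmaxProb_smul_score [Nonempty A] (θ : PolicyParam S A) (s : S) :
    ∑ a, softmaxProb θ s a • score θ s a = 0 := by
  classical
  simp only [score_eq, smul_sub, Finset.sum_sub_distrib]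
  rw [← Finset.sum_smul, sum_softmaxProb, one_smul, sub_self]

/-- Supplies the measurability of the estimator in the parameter. -/
theorem continuous_score [Nonempty A] (s : S) (a : A) :
    Continuous (fun θ : PolicyParam S A => score θ s a) := by
  classical
  simp only [score_eq, softmaxProb]
  have h : ∀ θ : PolicyParam S A, ∑ a', Real.exp (θ (s, a')) ≠ 0 := fun θ => (sum_exp_pos θ s).ne'
  fun_prop (disch := assumption)

theorem hasGradientAt_logBarrier [Nonempty A] (θ : PolicyParam S A) :
    HasGradientAt (logBarrier : PolicyParam S A → ℝ)
      ((1 / ((Fintype.card S : ℝ) * (Fintype.card A : ℝ))) • ∑ s, ∑ a, score θ s a) θ := by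
  rw [hasGradientAt_iff_hasFDerivAt]
  have h := (HasFDerivAt.fun_sum (u := (Finset.univ : Finset S)) fun s _ =>
    HasFDerivAt.fun_sum (u := (Finset.univ : Finset A)) fun a _ =>
      (hasGradientAt_log_softmaxProb θ s a).hasFDerivAt).const_mul
        (1 / ((Fintype.card S : ℝ) * (Fintype.card A : ℝ)))
  refine h.congr_fderiv ?_
  simp

theorem norm_regularizer_le [Nonempty S] [Nonempty A] {lam : ℝ} (hlam : 0 ≤ lam)
    (θ : PolicyParam S A) :
    ‖(lam / ((Fintype.card S : ℝ) * (Fintype.card A : ℝ))) • ∑ s, ∑ a, score θ s a‖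
      ≤ 2 * lam := by
  have hS : (0 : ℝ) < Fintype.card S := by exact_mod_cast Fintype.card_pos
  have hA : (0 : ℝ) < Fintype.card A := by exact_mod_cast Fintype.card_pos
  have h : ‖∑ s, ∑ a, score θ s a‖ ≤ ∑ _s : S, ∑ _a : A, (2 : ℝ) :=
    norm_sum_le_of_le _ fun s _ => norm_sum_le_of_le _ fun a _ => norm_score_le θ s a
  rw [norm_smul, Real.norm_of_nonneg (by positivity)]
  refine (mul_le_mul_of_nonneg_left h (by positivity)).trans_eq ?_
  simp
  field_simp

end SoftmaxCalculus

/-! ### Truncated paths. -/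

section Paths

/-- The path that follows `p` up to time `n` and then stays put. -/
def extendPath {X : Type*} (n : ℕ) (p : ∀ _ : Finset.Iic n, X) : ℕ → X :=
  fun i => p ⟨min i n, Finset.mem_Iic.2 (min_le_right i n)⟩

theorem extendPath_frestrictLe {X : Type*} (n : ℕ) (x : ℕ → X) :
    extendPath n (Preorder.frestrictLe (π := fun _ => X) n x) = stopPath n x := rfl

theorem frestrictLe_extendPath {X : Type*} (n : ℕ) (p : ∀ _ : Finset.Iic n, X) :
    Preorder.frestrictLe (π := fun _ => X) n (extendPath n p) = p := by
  funext i
  simp only [Preorder.frestrictLe_apply, extendPath]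
  congr 1
  exact Subtype.ext (min_eq_left (Finset.mem_Iic.1 i.2))

/-- Translates events about frozen paths, used in the sampling law, into cylinder events. -/
theorem stopPath_eq_extendPath_iff {X : Type*} (n : ℕ) (x : ℕ → X) (p : ∀ _ : Finset.Iic n, X) :
    stopPath n x = extendPath n p ↔ Preorder.frestrictLe (π := fun _ => X) n x = p := by
  rw [← extendPath_frestrictLe]
  refine ⟨fun h => ?_, fun h => by rw [h]⟩
  rw [← frestrictLe_extendPath n p, ← h, frestrictLe_extendPath]

theorem stopPath_apply_of_le {X : Type*} {n i : ℕ} (h : i ≤ n) (x : ℕ → X) :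
    stopPath n x i = x i := by
  rw [stopPath, min_eq_left h]

end Paths

/-! ### Finite-dimensional distributions of the trajectory. -/

namespace FiniteMDP

variable {S A : Type*}

theorem stateActionPMF_apply (q : PMF S) (π : S → PMF A) (s : S) (a : A) :
    stateActionPMF q π (s, a) = q s * π s a := by
  classical
  rw [stateActionPMF, PMF.bind_apply, tsum_eq_single s]
  · rw [PMF.map_apply, tsum_eq_single a]
    · simp
    · intro a' ha
      simp [ha.symm]
  · intro s' hs
    rw [PMF.map_apply]
    simp [hs.symm]

variable [MeasurableSpace S] [MeasurableSpace A] [DiscreteMeasurableSpace S]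
  [DiscreteMeasurableSpace A] [Finite S] [Finite A]

instance isProbabilityMeasure_trajLaw (M : FiniteMDP S A) (π : S → PMF A) :
    IsProbabilityMeasure (M.trajLaw π) := by
  unfold trajLaw
  have := PMF.toMeasure.isProbabilityMeasure (stateActionPMF M.initial π)
  exact (inferInstance : IsProbabilityMeasure
    (Kernel.trajMeasure (X := fun _ => S × A) (stateActionPMF M.initial π).toMeasure
      (M.stepKernel π)))

theorem map_trajLaw_compProd (M : FiniteMDP S A) (π : S → PMF A) (n : ℕ) :
    (M.trajLaw π).map (Preorder.frestrictLe n) ⊗ₘ M.stepKernel π n =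
      (M.trajLaw π).map (fun x => (Preorder.frestrictLe n x, x (n + 1))) := by
  have := PMF.toMeasure.isProbabilityMeasure (stateActionPMF M.initial π)
  exact Kernel.map_frestrictLe_trajMeasure_compProd_eq_map_trajMeasure

theorem map_trajLaw_frestrictLe_zero (M : FiniteMDP S A) (π : S → PMF A) :
    (M.trajLaw π).map (Preorder.frestrictLe 0) = (stateActionPMF M.initial π).toMeasure.map
      (MeasurableEquiv.piUnique (fun _ : Finset.Iic 0 => S × A)).symm := by
  unfold trajLaw Kernel.trajMeasure
  rw [Measure.map_comp _ _ (by fun_prop), Kernel.traj_map_frestrictLe, Kernel.partialTraj_self]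
  exact Measure.id_comp

theorem map_trajLaw_eval_zero (M : FiniteMDP S A) (π : S → PMF A) :
    (M.trajLaw π).map (fun x => x 0) = (stateActionPMF M.initial π).toMeasure := by
  have h := congrArg (Measure.map (fun p : ∀ _ : Finset.Iic 0, S × A =>
    p ⟨0, Finset.mem_Iic.2 le_rfl⟩)) (M.map_trajLaw_frestrictLe_zero π)
  rw [Measure.map_map (by fun_prop) (by fun_prop), Measure.map_map (by fun_prop) (by fun_prop)] at h
  refine h.trans ?_
  rw [show (fun p : ∀ _ : Finset.Iic 0, S × A => p ⟨0, Finset.mem_Iic.2 le_rfl⟩) ∘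
    (MeasurableEquiv.piUnique (fun _ : Finset.Iic 0 => S × A)).symm = id from
    funext fun _ => rfl, Measure.map_id]

/-- The policy-independent factor of the probability of the path `p` up to time `n`. -/
noncomputable def pathFactor (M : FiniteMDP S A) (n : ℕ) (p : ℕ → S × A) : ℝ :=
  (M.initial (p 0).1).toReal *
    ∏ i ∈ Finset.range n, (M.trans (p i).1 (p i).2 (p (i + 1)).1).toReal

/-- The chain rule for the Markov process, by induction on the last step. The dependence on the
policy is isolated in one product, which is all that differentiation in θ has to treat. -/
theorem trajLaw_real_cylinder (M : FiniteMDP S A) (π : S → PMF A) (n : ℕ) (p : ℕ → S × A) :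
    (M.trajLaw π).real {x | Preorder.frestrictLe (π := fun _ => S × A) n x =
        Preorder.frestrictLe (π := fun _ => S × A) n p} =
      M.pathFactor n p * ∏ i ∈ Finset.range (n + 1), (π (p i).1 (p i).2).toReal := by
  induction n with
  | zero =>
    have h : {x : ℕ → S × A | Preorder.frestrictLe (π := fun _ => S × A) 0 x =
        Preorder.frestrictLe (π := fun _ => S × A) 0 p} = (fun x => x 0) ⁻¹' {p 0} := by
      ext x
      simp only [Set.mem_ofPred_eq, Set.mem_preimage, Set.mem_singleton_iff, funext_iff,
        Preorder.frestrictLe_apply]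
      refine ⟨fun h => h ⟨0, Finset.mem_Iic.2 le_rfl⟩, fun h i => ?_⟩
      have : (i : ℕ) = 0 := Nat.le_zero.1 (Finset.mem_Iic.1 i.2)
      rw [this, h]
    rw [h, Measure.real, ← Measure.map_apply (by fun_prop) (measurableSet_singleton _),
      map_trajLaw_eval_zero, PMF.toMeasure_apply_singleton _ _ (measurableSet_singleton _),
      ← Prod.mk.eta (p := p 0), stateActionPMF_apply]
    simp [pathFactor]
  | succ n ih =>
    have h : {x : ℕ → S × A | Preorder.frestrictLe (π := fun _ => S × A) (n + 1) x =
        Preorder.frestrictLe (π := fun _ => S × A) (n + 1) p} =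
        (fun x => (Preorder.frestrictLe (π := fun _ => S × A) n x, x (n + 1))) ⁻¹'
          ({Preorder.frestrictLe (π := fun _ => S × A) n p} ×ˢ {p (n + 1)}) := by
      ext x
      simp only [Set.mem_ofPred_eq, Set.mem_preimage, Set.mem_singleton_iff, funext_iff,
        Preorder.frestrictLe_apply, Set.mem_prod]
      refine ⟨fun h => ⟨fun i => h ⟨i, Finset.mem_Iic.2
        ((Finset.mem_Iic.1 i.2).trans n.le_succ)⟩, h ⟨n + 1, Finset.mem_Iic.2 le_rfl⟩⟩,
        fun h i => ?_⟩
      rcases (Finset.mem_Iic.1 i.2).lt_or_eq with hi | hi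
      · exact h.1 ⟨i, Finset.mem_Iic.2 (Nat.lt_succ_iff.1 hi)⟩
      · rw [hi, h.2]
    rw [h, Measure.real, ← Measure.map_apply (by fun_prop)
      ((measurableSet_singleton _).prod (measurableSet_singleton _)),
      ← map_trajLaw_compProd, Measure.compProd_apply_prod (measurableSet_singleton _)
      (measurableSet_singleton _), Measure.restrict_singleton, lintegral_smul_measure,
      lintegral_dirac, smul_eq_mul, ENNReal.toReal_mul,
      Measure.map_apply (by fun_prop) (measurableSet_singleton _)]
    have h2 : M.stepKernel π n (Preorder.frestrictLe (π := fun _ => S × A) n p) {p (n + 1)} =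
        M.trans (p n).1 (p n).2 (p (n + 1)).1 * π (p (n + 1)).1 (p (n + 1)).2 := by
      change (stateActionPMF (M.trans (p n).1 (p n).2) π).toMeasure {p (n + 1)} = _
      rw [PMF.toMeasure_apply_singleton _ _ (measurableSet_singleton _), ← stateActionPMF_apply]
    rw [h2, ENNReal.toReal_mul]
    have ih' := ih
    rw [Measure.real] at ih'
    change ((M.trajLaw π) {x | Preorder.frestrictLe (π := fun _ => S × A) n x =
        Preorder.frestrictLe (π := fun _ => S × A) n p}).toReal * _ = _
    rw [ih', pathFactor, pathFactor,
      Finset.prod_range_succ (fun i => (M.trans (p i).1 (p i).2 (p (i + 1)).1).toReal) n,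
      Finset.prod_range_succ _ (n + 1)]
    ring

end FiniteMDP

/-! ### Finite-horizon expectations and their gradients. -/

namespace FiniteMDP

section FiniteHorizon

variable {S A : Type*} [MeasurableSpace S] [MeasurableSpace A] [DiscreteMeasurableSpace S]
  [DiscreteMeasurableSpace A] {E : Type*} [NormedAddCommGroup E]

/-- Such a function factors through the finite set of paths up to time n, so no bound or
measurability assumption is needed. -/
theorem integrable_of_stopPath [Finite S] [Finite A] {n : ℕ} {f : (ℕ → S × A) → E}
    (hf : ∀ x, f x = f (stopPath n x)) (P : Measure (ℕ → S × A)) [IsFiniteMeasure P] :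
    Integrable f P := by
  have h : f = (fun p => f (extendPath n p)) ∘ Preorder.frestrictLe (π := fun _ => S × A) n :=
    funext hf
  rw [h]
  exact Integrable.comp_measurable Integrable.of_finite (Preorder.measurable_frestrictLe n)

theorem integral_eq_sum_of_stopPath [NormedSpace ℝ E] [CompleteSpace E] [Fintype S] [Fintype A]
    (P : Measure (ℕ → S × A)) [IsFiniteMeasure P] (n : ℕ) {f : (ℕ → S × A) → E}
    (hf : ∀ x, f x = f (stopPath n x)) :
    ∫ x, f x ∂P = ∑ p : (∀ _ : Finset.Iic n, S × A),
      P.real {x | Preorder.frestrictLe (π := fun _ => S × A) n x = p} • f (extendPath n p) := by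
  have h : ∀ x, f x = (fun p => f (extendPath n p))
      (Preorder.frestrictLe (π := fun _ => S × A) n x) := hf
  have hm := Preorder.measurable_frestrictLe (X := fun _ : ℕ => S × A) n
  rw [integral_congr_ae (Filter.Eventually.of_forall h),
    ← integral_map hm.aemeasurable (f := fun p => f (extendPath n p))
      StronglyMeasurable.of_discrete.aestronglyMeasurable,
    integral_fintype Integrable.of_finite]
  refine Finset.sum_congr rfl fun p _ => ?_
  rw [map_measureReal_apply hm (measurableSet_singleton _)]
  rfl

theorem integral_trajLaw_eq_sum [NormedSpace ℝ E] [CompleteSpace E] [Fintype S] [Fintype A]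
    (M : FiniteMDP S A) (π : S → PMF A) (n : ℕ) {f : (ℕ → S × A) → E}
    (hf : ∀ x, f x = f (stopPath n x)) :
    ∫ x, f x ∂M.trajLaw π = ∑ p : (∀ _ : Finset.Iic n, S × A),
      (M.pathFactor n (extendPath n p) * ∏ i ∈ Finset.range (n + 1),
        (π (extendPath n p i).1 (extendPath n p i).2).toReal) • f (extendPath n p) := by
  rw [integral_eq_sum_of_stopPath _ n hf]
  refine Finset.sum_congr rfl fun p _ => ?_
  rw [← trajLaw_real_cylinder, frestrictLe_extendPath]

/-- A function of the state-action pair whose mean under the policy vanishes at every state has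
mean zero at every time. -/
theorem integral_eval_eq_zero [NormedSpace ℝ E] [CompleteSpace E] [Fintype S] [Fintype A]
    (M : FiniteMDP S A) (π : S → PMF A) {f : S × A → E}
    (hf : ∀ s, ∑ a, (π s a).toReal • f (s, a) = 0) (t : ℕ) :
    ∫ x, f (x t) ∂M.trajLaw π = 0 := by
  -- The state distribution is arbitrary: given the past, a pair is always a state from some q
  -- followed by an action from π.
  have key : ∀ q : PMF S, ∫ z, f z ∂(stateActionPMF q π).toMeasure = 0 := fun q => by
    rw [PMF.integral_eq_sum, Fintype.sum_prod_type]
    refine Finset.sum_eq_zero fun s _ => ?_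
    simp only [stateActionPMF_apply, ENNReal.toReal_mul, mul_smul]
    rw [← Finset.smul_sum, hf, smul_zero]
  have hsm : StronglyMeasurable f := .of_discrete
  cases t with
  | zero =>
    rw [← integral_map (f := f) (φ := fun x : ℕ → S × A => x 0)
      (measurable_pi_apply 0).aemeasurable hsm.aestronglyMeasurable, map_trajLaw_eval_zero, key]
  | succ t =>
    have h := integral_map (μ := M.trajLaw π) (f := fun y : (∀ _ : Finset.Iic t, S × A) × (S × A) =>
      f y.2) (φ := fun x => (Preorder.frestrictLe t x, x (t + 1))) (by fun_prop)
      (hsm.comp_measurable measurable_snd).aestronglyMeasurable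
    have := Measure.isProbabilityMeasure_map (μ := M.trajLaw π)
      (Preorder.measurable_frestrictLe (X := fun _ : ℕ => S × A) t).aemeasurable
    rw [← h, ← map_trajLaw_compProd, Measure.integral_compProd Integrable.of_finite]
    refine integral_eq_zero_of_ae (Filter.Eventually.of_forall fun p => ?_)
    exact key _

end FiniteHorizon

section Gradient

variable {S A : Type*} [Fintype S] [Fintype A] [Nonempty A]

/-- The log-derivative trick: the product is the exponential of a sum of logarithms. -/
theorem hasGradientAt_prod_softmaxProb (θ : PolicyParam S A) (s : Finset ℕ) (x : ℕ → S × A) :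
    HasGradientAt (fun η : PolicyParam S A => ∏ i ∈ s, softmaxProb η (x i).1 (x i).2)
      ((∏ i ∈ s, softmaxProb θ (x i).1 (x i).2) • ∑ i ∈ s, score θ (x i).1 (x i).2) θ := by
  have h : ∀ η : PolicyParam S A, ∏ i ∈ s, softmaxProb η (x i).1 (x i).2 =
      Real.exp (∑ i ∈ s, Real.log (softmaxProb η (x i).1 (x i).2)) := fun η => by
    rw [Real.exp_sum]
    exact Finset.prod_congr rfl fun i _ => (Real.exp_log (softmaxProb_pos η _ _)).symm
  simp only [h, hasGradientAt_iff_hasFDerivAt]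
  refine (HasFDerivAt.fun_sum fun i _ =>
    (hasGradientAt_log_softmaxProb θ (x i).1 (x i).2).hasFDerivAt).exp.congr_fderiv ?_
  simp

variable [MeasurableSpace S] [MeasurableSpace A] [DiscreteMeasurableSpace S]
  [DiscreteMeasurableSpace A]

/-- The score-function identity for a functional of the first `n + 1` state-action pairs. -/
theorem hasGradientAt_integral_trajLaw (M : FiniteMDP S A) (θ : PolicyParam S A) {n : ℕ}
    {f : (ℕ → S × A) → ℝ} (hf : ∀ x, f x = f (stopPath n x)) :
    HasGradientAt (fun η => ∫ x, f x ∂M.trajLaw (softmaxPolicy η))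
      (∫ x, f x • ∑ i ∈ Finset.range (n + 1), score θ (x i).1 (x i).2
        ∂M.trajLaw (softmaxPolicy θ)) θ := by
  have hg : ∀ x : ℕ → S × A, f x • ∑ i ∈ Finset.range (n + 1), score θ (x i).1 (x i).2 =
      f (stopPath n x) • ∑ i ∈ Finset.range (n + 1),
        score θ (stopPath n x i).1 (stopPath n x i).2 := fun x => by
    rw [← hf]
    congr 1
    refine Finset.sum_congr rfl fun i hi => ?_
    rw [stopPath_apply_of_le (Nat.lt_succ_iff.1 (Finset.mem_range.1 hi))]
  -- Both expectations become finite sums over paths, so the gradient can be computed term by term.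
  simp only [M.integral_trajLaw_eq_sum _ n hf, softmaxPolicy_toReal]
  rw [M.integral_trajLaw_eq_sum _ n hg, hasGradientAt_iff_hasFDerivAt]
  simp only [softmaxPolicy_toReal]
  have h := HasFDerivAt.fun_sum (u := (Finset.univ : Finset (∀ _ : Finset.Iic n, S × A)))
    fun p _ => (((hasGradientAt_prod_softmaxProb θ (Finset.range (n + 1))
      (extendPath n p)).hasFDerivAt.const_mul (M.pathFactor n (extendPath n p))).mul_const
        (f (extendPath n p)))
  refine h.congr_fderiv ?_
  simp only [map_sum, map_smul, smul_smul]
  refine Finset.sum_congr rfl fun p _ => ?_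
  congr 1
  ring

end Gradient
end FiniteMDP

/-! ### The policy gradient as a double series. -/

namespace FiniteMDP

section PolicyGradient

variable {S A : Type*}

theorem hasSum_discount_pow (M : FiniteMDP S A) :
    HasSum (fun t : ℕ => M.discount ^ t) (1 - M.discount)⁻¹ :=
  hasSum_geometric_of_lt_one M.discount_nonneg M.discount_lt_one

theorem hasSum_discount_mul_discount (M : FiniteMDP S A) :
    HasSum (fun q : ℕ × ℕ => 2 * (M.discount ^ q.1 * M.discount ^ q.2))
      (2 / (1 - M.discount) ^ 2) := by
  have hs := M.hasSum_discount_pow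
  have h := (hs.mul hs (hs.summable.mul_of_nonneg hs.summable
    (fun t => pow_nonneg M.discount_nonneg t)
    (fun t => pow_nonneg M.discount_nonneg t))).mul_left 2
  rwa [← sq, inv_pow, ← div_eq_mul_inv] at h

theorem abs_reward_le_one (M : FiniteMDP S A) (s : S) (a : A) : |M.reward s a| ≤ 1 := by
  rw [abs_of_nonneg (M.reward_nonneg s a)]
  exact M.reward_le_one s a

variable [Fintype S] [Fintype A]

theorem norm_reward_smul_sum_score_le [Nonempty A] (M : FiniteMDP S A) (θ : PolicyParam S A)
    (z : S × A) (s : Finset ℕ) (x : ℕ → S × A) :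
    ‖M.reward z.1 z.2 • ∑ i ∈ s, score θ (x i).1 (x i).2‖ ≤ 2 * s.card := by
  have h : ‖∑ i ∈ s, score θ (x i).1 (x i).2‖ ≤ ∑ _i ∈ s, (2 : ℝ) :=
    norm_sum_le_of_le _ fun i _ => norm_score_le θ _ _
  rw [norm_smul, Real.norm_eq_abs]
  refine (mul_le_mul (M.abs_reward_le_one _ _) h (norm_nonneg _) zero_le_one).trans_eq ?_
  simp [mul_comm]

variable [MeasurableSpace S] [MeasurableSpace A] [DiscreteMeasurableSpace S]
  [DiscreteMeasurableSpace A]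

theorem value_eq_tsum (M : FiniteMDP S A) (π : S → PMF A) :
    M.value π = ∑' t : ℕ, ∫ x, M.discount ^ t * M.reward (x t).1 (x t).2 ∂M.trajLaw π := by
  have hi : ∀ t : ℕ, Integrable
      (fun x : ℕ → S × A => M.discount ^ t * M.reward (x t).1 (x t).2) (M.trajLaw π) := fun t =>
    integrable_of_stopPath (n := t) (fun x => by rw [stopPath_apply_of_le le_rfl]) _
  refine (integral_tsum_of_summable_integral_norm hi ?_).symm
  refine Summable.of_nonneg_of_le (fun t => integral_nonneg fun x => norm_nonneg _) (fun t => ?_)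
    M.hasSum_discount_pow.summable
  refine (integral_mono (hi t).norm (integrable_const (M.discount ^ t)) fun x => ?_).trans_eq
    (by simp)
  rw [norm_mul, norm_pow, Real.norm_of_nonneg M.discount_nonneg, Real.norm_eq_abs]
  exact mul_le_of_le_one_right (pow_nonneg M.discount_nonneg _) (M.abs_reward_le_one _ _)

variable [Nonempty A]

/-- The contribution to the policy gradient of the action at time `t` through the reward
collected `d` steps later. -/
noncomputable def policyGradientTerm (M : FiniteMDP S A) (θ : PolicyParam S A) (q : ℕ × ℕ) :
    PolicyParam S A :=
  M.discount ^ (q.1 + q.2) • ∫ x, M.reward (x (q.1 + q.2)).1 (x (q.1 + q.2)).2 •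
    score θ (x q.1).1 (x q.1).2 ∂M.trajLaw (softmaxPolicy θ)

theorem norm_policyGradientTerm_le (M : FiniteMDP S A) (θ : PolicyParam S A) (q : ℕ × ℕ) :
    ‖M.policyGradientTerm θ q‖ ≤ 2 * (M.discount ^ q.1 * M.discount ^ q.2) := by
  have h : ‖∫ x, M.reward (x (q.1 + q.2)).1 (x (q.1 + q.2)).2 •
      score θ (x q.1).1 (x q.1).2 ∂M.trajLaw (softmaxPolicy θ)‖ ≤ 2 := by
    have := norm_integral_le_of_norm_le_const (μ := M.trajLaw (softmaxPolicy θ))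
      (Filter.Eventually.of_forall fun x => by
        have := M.norm_reward_smul_sum_score_le θ (x (q.1 + q.2)) {q.1} x
        simpa using this)
    simpa using this
  rw [policyGradientTerm, norm_smul, norm_pow, Real.norm_of_nonneg M.discount_nonneg, ← pow_add,
    mul_comm (2 : ℝ)]
  exact mul_le_mul_of_nonneg_left h (pow_nonneg M.discount_nonneg _)

theorem summable_policyGradientTerm (M : FiniteMDP S A) (θ : PolicyParam S A) :
    Summable (M.policyGradientTerm θ) :=
  Summable.of_norm_bounded M.hasSum_discount_mul_discount.summable
    (M.norm_policyGradientTerm_le θ)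

/-- The pairs (t, d) with t + d = n are those acting through the reward at time n, so an
antidiagonal sum is the gradient of one expected discounted reward. -/
theorem sum_antidiagonal_policyGradientTerm (M : FiniteMDP S A) (θ : PolicyParam S A) (n : ℕ) :
    ∑ q ∈ Finset.HasAntidiagonal.antidiagonal n, M.policyGradientTerm θ q =
      ∫ x, (M.discount ^ n * M.reward (x n).1 (x n).2) •
        ∑ i ∈ Finset.range (n + 1), score θ (x i).1 (x i).2 ∂M.trajLaw (softmaxPolicy θ) := by
  rw [Finset.Nat.sum_antidiagonal_eq_sum_range_succ_mk]
  simp only [Finset.smul_sum]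
  rw [integral_finsetSum]
  · refine Finset.sum_congr rfl fun i hi => ?_
    rw [policyGradientTerm, ← integral_smul,
      Nat.add_sub_cancel' (Nat.lt_succ_iff.1 (Finset.mem_range.1 hi))]
    simp only [mul_smul]
  · intro i hi
    exact integrable_of_stopPath (n := n) (fun x => by
      rw [stopPath_apply_of_le le_rfl,
        stopPath_apply_of_le (Nat.lt_succ_iff.1 (Finset.mem_range.1 hi))]) _

/-- The policy gradient theorem. -/
theorem hasGradientAt_value (M : FiniteMDP S A) (θ : PolicyParam S A) :
    HasGradientAt (fun η => M.value (softmaxPolicy η)) (∑' q, M.policyGradientTerm θ q) θ := by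
  have hsum : ∑' q, M.policyGradientTerm θ q =
      ∑' n, ∑ q ∈ Finset.HasAntidiagonal.antidiagonal n, M.policyGradientTerm θ q := by
    conv_rhs => congr; ext; rw [← Finset.sum_finset_coe, ← tsum_fintype (L := .unconditional _)]
    rw [← Finset.HasAntidiagonal.sigmaAntidiagonalEquivProd.tsum_eq]
    exact (Finset.HasAntidiagonal.sigmaAntidiagonalEquivProd.summable_iff.2
      (M.summable_policyGradientTerm θ)).tsum_sigma' fun n => (hasSum_fintype _).summable
  simp only [hsum, sum_antidiagonal_policyGradientTerm, value_eq_tsum]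
  have hgrad : ∀ (n : ℕ) (η : PolicyParam S A), HasGradientAt
      (fun η => ∫ x, M.discount ^ n * M.reward (x n).1 (x n).2 ∂M.trajLaw (softmaxPolicy η))
      (∫ x, (M.discount ^ n * M.reward (x n).1 (x n).2) •
        ∑ i ∈ Finset.range (n + 1), score η (x i).1 (x i).2 ∂M.trajLaw (softmaxPolicy η)) η :=
    fun n η => M.hasGradientAt_integral_trajLaw η fun x => by rw [stopPath_apply_of_le le_rfl]
  -- The n + 1 scores, each of norm at most 2, cost a factor 2(n + 1). The bound is uniform in η and
  -- summable against γ^n, as termwise differentiation requires.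
  have hbound : ∀ (n : ℕ) (η : PolicyParam S A),
      ‖∫ x, (M.discount ^ n * M.reward (x n).1 (x n).2) •
        ∑ i ∈ Finset.range (n + 1), score η (x i).1 (x i).2 ∂M.trajLaw (softmaxPolicy η)‖ ≤
      2 * ((n : ℝ) * M.discount ^ n + M.discount ^ n) := fun n η => by
    refine (norm_integral_le_of_norm_le_const (C := 2 * ((n : ℝ) * M.discount ^ n + M.discount ^ n))
      (Filter.Eventually.of_forall fun x => ?_)).trans_eq (by simp)
    rw [mul_smul, norm_smul, norm_pow, Real.norm_of_nonneg M.discount_nonneg]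
    refine (mul_le_mul_of_nonneg_left (M.norm_reward_smul_sum_score_le η _ _ x)
      (pow_nonneg M.discount_nonneg _)).trans_eq ?_
    rw [Finset.card_range]
    push_cast
    ring
  have hu : Summable fun n : ℕ => 2 * ((n : ℝ) * M.discount ^ n + M.discount ^ n) := by
    have h1 := summable_pow_mul_geometric_of_norm_lt_one 1 (r := M.discount)
      (by rw [Real.norm_of_nonneg M.discount_nonneg]; exact M.discount_lt_one)
    simp only [pow_one] at h1
    exact (h1.add M.hasSum_discount_pow.summable).mul_left 2
  have hsummable : ∀ η : PolicyParam S A, Summable fun n : ℕ =>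
      ∫ x, (M.discount ^ n * M.reward (x n).1 (x n).2) •
        ∑ i ∈ Finset.range (n + 1), score η (x i).1 (x i).2 ∂M.trajLaw (softmaxPolicy η) :=
    fun η => hu.of_norm_bounded fun n => hbound n η
  rw [hasGradientAt_iff_hasFDerivAt]
  have h := hasFDerivAt_tsum hu (fun n η => (hgrad n η).hasFDerivAt)
    (fun n η => by rw [LinearIsometryEquiv.norm_map]; exact hbound n η) (x₀ := θ) ?_ θ
  · refine h.congr_fderiv ?_
    exact ((InnerProductSpace.toDual ℝ (PolicyParam S A)).toContinuousLinearEquiv.map_tsum).symm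
  -- Termwise differentiation also needs the value series to converge at one point.
  · refine M.hasSum_discount_pow.summable.of_norm_bounded fun n => ?_
    refine (norm_integral_le_of_norm_le_const (C := M.discount ^ n)
      (Filter.Eventually.of_forall fun x => ?_)).trans_eq (by simp)
    rw [norm_mul, norm_pow, Real.norm_of_nonneg M.discount_nonneg, Real.norm_eq_abs]
    exact mul_le_of_le_one_right (pow_nonneg M.discount_nonneg _) (M.abs_reward_le_one _ _)

theorem hasGradientAt_surrogate (M : FiniteMDP S A) (lam : ℝ) (θ : PolicyParam S A) :
    HasGradientAt (M.surrogate lam) (∑' q, M.policyGradientTerm θ q +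
      (lam / ((Fintype.card S : ℝ) * (Fintype.card A : ℝ))) • ∑ s, ∑ a, score θ s a) θ := by
  have h := (M.hasGradientAt_value θ).hasFDerivAt.add
    ((hasGradientAt_logBarrier θ).hasFDerivAt.const_mul lam)
  rw [hasGradientAt_iff_hasFDerivAt]
  refine h.congr_fderiv ?_
  rw [map_add, ← map_smul, smul_smul, mul_one_div]

theorem norm_gradient_surrogate_le [Nonempty S] (M : FiniteMDP S A) {lam : ℝ} (hlam : 0 ≤ lam)
    (θ : PolicyParam S A) :
    ‖gradient (M.surrogate lam) θ‖ ≤ 2 / (1 - M.discount) ^ 2 + 2 * lam := by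
  rw [(M.hasGradientAt_surrogate lam θ).gradient]
  exact (norm_add_le _ _).trans (add_le_add
    (tsum_of_norm_bounded M.hasSum_discount_mul_discount (M.norm_policyGradientTerm_le θ))
    (norm_regularizer_le hlam θ))

end PolicyGradient
end FiniteMDP

/-! ### Mean and truncation bias of the estimator. -/

theorem hasSum_ite_mem {ι E : Type*} [AddCommMonoid E] [TopologicalSpace E] [DecidableEq ι]
    (F : Finset ι) (f : ι → E) :
    HasSum (fun i => if i ∈ F then f i else 0) (∑ i ∈ F, f i) := by
  have h : HasSum (fun i => if i ∈ F then f i else 0) (∑ i ∈ F, if i ∈ F then f i else 0) :=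
    hasSum_sum_of_ne_finset_zero fun i hi => if_neg hi
  rwa [Finset.sum_congr rfl fun i hi => if_pos hi] at h

namespace FiniteMDP

section Bias

variable {S A : Type*}

theorem hasSum_ite_discount_pow (M : FiniteMDP S A) (m : ℕ) :
    HasSum (fun t : ℕ => if m ≤ t then M.discount ^ t else 0)
      (M.discount ^ m * (1 - M.discount)⁻¹) := by
  rw [← hasSum_nat_add_iff' m]
  have h0 : ∑ i ∈ Finset.range m, (if m ≤ i then M.discount ^ i else 0) = 0 :=
    Finset.sum_eq_zero fun i hi => if_neg (not_le.2 (Finset.mem_range.1 hi))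
  rw [h0, sub_zero]
  simpa [pow_add, mul_comm] using M.hasSum_discount_pow.mul_left (M.discount ^ m)

theorem qHat_nonneg (M : FiniteMDP S A) (H : ℕ) (x : ℕ → S × A) (t : ℕ) : 0 ≤ M.qHat H x t :=
  Finset.sum_nonneg fun _ _ => mul_nonneg (pow_nonneg M.discount_nonneg _) (M.reward_nonneg _ _)

/-- Reindexed by the delay d, so that the weights γ^t γ^d match the double series. -/
theorem qHat_eq_sum_range (M : FiniteMDP S A) (H : ℕ) (x : ℕ → S × A) (t : ℕ) :
    M.qHat H x t = ∑ d ∈ (Finset.range (H + 1)).filter (fun d => t + d ≤ H),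
      M.discount ^ d * M.reward (x (t + d)).1 (x (t + d)).2 := by
  refine Finset.sum_nbij' (fun t' => t' - t) (fun d => t + d) ?_ ?_ ?_ ?_ ?_
  · intro i hi
    simp only [Finset.mem_Icc, Finset.mem_filter, Finset.mem_range] at hi ⊢
    omega
  · intro i hi
    simp only [Finset.mem_Icc, Finset.mem_filter, Finset.mem_range] at hi ⊢
    omega
  · intro i hi
    simp only [Finset.mem_Icc] at hi
    omega
  · intro i _
    omega
  · intro i hi
    simp only [Finset.mem_Icc] at hi
    rw [Nat.add_sub_cancel' hi.1]

theorem qHat_le (M : FiniteMDP S A) (H : ℕ) (x : ℕ → S × A) (t : ℕ) :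
    M.qHat H x t ≤ (1 - M.discount)⁻¹ := by
  rw [qHat_eq_sum_range]
  refine (Finset.sum_le_sum fun d _ => mul_le_of_le_one_right (pow_nonneg M.discount_nonneg d)
    (M.reward_le_one _ _)).trans ?_
  exact sum_le_hasSum _ (fun d _ => pow_nonneg M.discount_nonneg d) M.hasSum_discount_pow

theorem qHat_stopPath (M : FiniteMDP S A) (H : ℕ) (x : ℕ → S × A) (t : ℕ) :
    M.qHat H (stopPath H x) t = M.qHat H x t :=
  Finset.sum_congr rfl fun _ hi => by rw [stopPath_apply_of_le (Finset.mem_Icc.1 hi).2]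

theorem floor_mul_le {β : ℝ} (hβ1 : β ≤ 1) (H : ℕ) : ⌊β * (H : ℝ)⌋₊ ≤ H :=
  Nat.floor_le_of_le (mul_le_of_le_one_left (Nat.cast_nonneg H) hβ1)

variable [Fintype S] [Fintype A]

/-- Since β ≤ 1, the last score used has time ⌊βH⌋ ≤ H, so nothing after the horizon is read. -/
theorem reinforce_eq_stopPath (M : FiniteMDP S A) {β : ℝ} (hβ1 : β ≤ 1) (b : S → ℝ) (lam : ℝ)
    (θ : PolicyParam S A) (H : ℕ) (x : ℕ → S × A) :
    M.reinforce β b lam θ H x = M.reinforce β b lam θ H (stopPath H x) := by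
  simp only [reinforce, qHat_stopPath]
  congr 1
  refine Finset.sum_congr rfl fun t ht => ?_
  rw [stopPath_apply_of_le
    ((Nat.lt_succ_iff.1 (Finset.mem_range.1 ht)).trans (floor_mul_le hβ1 H))]

/-- Each bracket is at most 1/(1-γ) + B, each score at most 2, and the weights γ^t sum to at most
1/(1-γ). -/
theorem norm_reinforce_le [Nonempty S] [Nonempty A] (M : FiniteMDP S A) (β : ℝ) {b : S → ℝ}
    {B : ℝ} (hb : ∀ s, |b s| ≤ B) {lam : ℝ} (hlam : 0 ≤ lam) (θ : PolicyParam S A) (H : ℕ)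
    (x : ℕ → S × A) :
    ‖M.reinforce β b lam θ H x‖ ≤
      2 * (1 + B * (1 - M.discount)) / (1 - M.discount) ^ 2 + 2 * lam := by
  have hγ : 0 < 1 - M.discount := sub_pos.2 M.discount_lt_one
  obtain ⟨s₀⟩ := ‹Nonempty S›
  have hB : 0 ≤ B := (abs_nonneg _).trans (hb s₀)
  refine (norm_add_le _ _).trans (add_le_add ?_ (norm_regularizer_le hlam θ))
  have h : ∀ t ∈ Finset.range (⌊β * (H : ℝ)⌋₊ + 1),
      ‖(M.discount ^ t * (M.qHat H x t - b (x t).1)) • score θ (x t).1 (x t).2‖ ≤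
        M.discount ^ t * (((1 - M.discount)⁻¹ + B) * 2) := fun t _ => by
    rw [norm_smul, norm_mul, norm_pow, Real.norm_of_nonneg M.discount_nonneg, mul_assoc]
    refine mul_le_mul_of_nonneg_left (mul_le_mul ?_ (norm_score_le _ _ _) (norm_nonneg _)
      (by positivity)) (pow_nonneg M.discount_nonneg t)
    refine (norm_sub_le _ _).trans (add_le_add ?_ (hb _))
    rw [Real.norm_of_nonneg (M.qHat_nonneg H x t)]
    exact M.qHat_le H x t
  refine (norm_sum_le_of_le _ h).trans ?_
  rw [← Finset.sum_mul]
  refine (mul_le_mul_of_nonneg_right (sum_le_hasSum _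
    (fun t _ => pow_nonneg M.discount_nonneg t) M.hasSum_discount_pow) (by positivity)).trans_eq ?_
  field_simp

variable [Nonempty A] [MeasurableSpace S] [MeasurableSpace A] [DiscreteMeasurableSpace S]
  [DiscreteMeasurableSpace A]

/-- The index pairs (action time, delay) of the rewards used by the REINFORCE estimator. -/
def reinforceIndices (N H : ℕ) : Finset (ℕ × ℕ) :=
  (Finset.range (N + 1) ×ˢ Finset.range (H + 1)).filter fun q => q.1 + q.2 ≤ H

theorem integral_baseline_smul_score (M : FiniteMDP S A) (θ : PolicyParam S A) (b : S → ℝ)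
    (t : ℕ) :
    ∫ x, b (x t).1 • score θ (x t).1 (x t).2 ∂M.trajLaw (softmaxPolicy θ) = 0 := by
  refine M.integral_eval_eq_zero (softmaxPolicy θ) (f := fun z => b z.1 • score θ z.1 z.2)
    (fun s => ?_) t
  simp only [softmaxPolicy_toReal, smul_comm _ (b s)]
  rw [← Finset.smul_sum, sum_softmaxProb_smul_score, smul_zero]

/-- The baseline terms integrate to zero and the reward terms are exactly the entries of the policy
gradient series, so truncation is the only source of bias. -/
theorem integral_reinforce (M : FiniteMDP S A) {β : ℝ} (hβ1 : β ≤ 1) (b : S → ℝ) (lam : ℝ)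
    (θ : PolicyParam S A) (H : ℕ) :
    ∫ x, M.reinforce β b lam θ H x ∂M.trajLaw (softmaxPolicy θ) =
      ∑ q ∈ reinforceIndices ⌊β * (H : ℝ)⌋₊ H, M.policyGradientTerm θ q +
      (lam / ((Fintype.card S : ℝ) * (Fintype.card A : ℝ))) • ∑ s, ∑ a, score θ s a := by
  have hr : ∀ t d : ℕ, Integrable (fun x : ℕ → S × A =>
      (M.discount ^ (t + d) * M.reward (x (t + d)).1 (x (t + d)).2) • score θ (x t).1 (x t).2)
      (M.trajLaw (softmaxPolicy θ)) := fun t d =>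
    integrable_of_stopPath (n := t + d) (fun x => by
      rw [stopPath_apply_of_le le_rfl, stopPath_apply_of_le (Nat.le_add_right t d)]) _
  have hbs : ∀ t : ℕ, Integrable (fun x : ℕ → S × A =>
      M.discount ^ t • b (x t).1 • score θ (x t).1 (x t).2)
      (M.trajLaw (softmaxPolicy θ)) := fun t =>
    integrable_of_stopPath (n := t) (fun x => by rw [stopPath_apply_of_le le_rfl]) _
  have hsplit : ∀ x, M.reinforce β b lam θ H x =
      ∑ t ∈ Finset.range (⌊β * (H : ℝ)⌋₊ + 1),
        (∑ d ∈ (Finset.range (H + 1)).filter (fun d => t + d ≤ H),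
          (M.discount ^ (t + d) * M.reward (x (t + d)).1 (x (t + d)).2) • score θ (x t).1 (x t).2
          - M.discount ^ t • b (x t).1 • score θ (x t).1 (x t).2) +
      (lam / ((Fintype.card S : ℝ) * (Fintype.card A : ℝ))) • ∑ s, ∑ a, score θ s a := fun x => by
    rw [reinforce]
    congr 1
    refine Finset.sum_congr rfl fun t _ => ?_
    rw [mul_sub, sub_smul, smul_smul, qHat_eq_sum_range, Finset.mul_sum, Finset.sum_smul]
    simp only [pow_add, mul_assoc]
  have hd : ∀ t : ℕ, Integrable (fun x : ℕ → S × A =>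
      ∑ d ∈ (Finset.range (H + 1)).filter (fun d => t + d ≤ H),
        (M.discount ^ (t + d) * M.reward (x (t + d)).1 (x (t + d)).2) • score θ (x t).1 (x t).2)
      (M.trajLaw (softmaxPolicy θ)) := fun t => integrable_finsetSum _ fun d _ => hr t d
  have hdb : ∀ t : ℕ, Integrable (fun x : ℕ → S × A =>
      ∑ d ∈ (Finset.range (H + 1)).filter (fun d => t + d ≤ H),
        (M.discount ^ (t + d) * M.reward (x (t + d)).1 (x (t + d)).2) • score θ (x t).1 (x t).2
        - M.discount ^ t • b (x t).1 • score θ (x t).1 (x t).2)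
      (M.trajLaw (softmaxPolicy θ)) := fun t => (hd t).sub (hbs t)
  simp only [hsplit]
  rw [integral_add (integrable_finsetSum _ fun t _ => hdb t) (integrable_const _),
    integral_const, probReal_univ, one_smul, integral_finsetSum _ fun t _ => hdb t]
  congr 1
  rw [reinforceIndices, Finset.sum_filter, Finset.sum_product]
  refine Finset.sum_congr rfl fun t _ => ?_
  rw [← Finset.sum_filter, integral_sub (hd t) (hbs t), integral_smul,
    integral_baseline_smul_score, smul_zero, sub_zero, integral_finsetSum _ fun d _ => hr t d]
  refine Finset.sum_congr rfl fun d _ => ?_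
  simp only [policyGradientTerm, mul_smul]
  rw [integral_smul]

/-- The indicator of the complement of F is at most the sum of the indicators of m ≤ t and of k ≤ d.
Each resulting series factors into a geometric tail and a full geometric series. -/
theorem norm_tsum_sub_sum_policyGradientTerm_le (M : FiniteMDP S A) (θ : PolicyParam S A)
    {m k : ℕ} {F : Finset (ℕ × ℕ)} (hF : ∀ q, q ∉ F → m ≤ q.1 ∨ k ≤ q.2) :
    ‖∑' q, M.policyGradientTerm θ q - ∑ q ∈ F, M.policyGradientTerm θ q‖ ≤
      2 * (M.discount ^ m + M.discount ^ k) / (1 - M.discount) ^ 2 := by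
  have h1 : HasSum (fun q => if q ∈ F then M.policyGradientTerm θ q else 0)
      (∑ q ∈ F, M.policyGradientTerm θ q) :=
    hasSum_ite_mem _ _
  have h2 := (M.summable_policyGradientTerm θ).hasSum.sub h1
  have hu := M.hasSum_ite_discount_pow m
  have hv := M.hasSum_ite_discount_pow k
  have hw := M.hasSum_discount_pow
  have hnn : ∀ m t : ℕ, (0 : ℝ) ≤ if m ≤ t then M.discount ^ t else 0 := fun m t => by
    split_ifs
    exacts [pow_nonneg M.discount_nonneg t, le_rfl]
  have h3 := ((hu.mul hw (hu.summable.mul_of_nonneg hw.summable (hnn _)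
    fun t => pow_nonneg M.discount_nonneg t)).add
      (hw.mul hv (hw.summable.mul_of_nonneg hv.summable
        (fun t => pow_nonneg M.discount_nonneg t) (hnn _)))).mul_left 2
  refine (h2.norm_le_of_bounded h3 fun q => ?_).trans_eq ?_
  · have hp1 := pow_nonneg M.discount_nonneg q.1
    have hp2 := pow_nonneg M.discount_nonneg q.2
    by_cases hq : q ∈ F
    · rw [if_pos hq, sub_self, norm_zero]
      exact mul_nonneg zero_le_two
        (add_nonneg (mul_nonneg (hnn _ _) hp2) (mul_nonneg hp1 (hnn _ _)))
    · rw [if_neg hq, sub_zero]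
      refine (M.norm_policyGradientTerm_le θ q).trans (mul_le_mul_of_nonneg_left ?_ zero_le_two)
      rcases hF q hq with h | h
      · rw [if_pos h]
        exact le_add_of_nonneg_right (mul_nonneg hp1 (hnn _ _))
      · rw [if_pos h]
        exact le_add_of_nonneg_left (mul_nonneg (hnn _ _) hp2)
  · rw [div_eq_mul_inv, ← inv_pow]
    ring

/-- The bias caused by truncating the trajectory and discarding late actions. -/
theorem norm_gradient_sub_integral_reinforce_le (M : FiniteMDP S A) {β : ℝ} (hβ1 : β ≤ 1)
    (b : S → ℝ) (lam : ℝ) (θ : PolicyParam S A) (H : ℕ) :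
    ‖gradient (M.surrogate lam) θ -
        ∫ x, M.reinforce β b lam θ H x ∂M.trajLaw (softmaxPolicy θ)‖ ≤
      2 * (M.discount ^ (⌊β * (H : ℝ)⌋₊ + 1) + M.discount ^ (H - ⌊β * (H : ℝ)⌋₊ + 1)) /
        (1 - M.discount) ^ 2 := by
  rw [M.integral_reinforce hβ1, (M.hasGradientAt_surrogate lam θ).gradient,
    add_sub_add_right_eq_sub]
  refine M.norm_tsum_sub_sum_policyGradientTerm_le θ fun q hq => ?_
  have hN := floor_mul_le hβ1 H
  rw [reinforceIndices, Finset.mem_filter, Finset.mem_product, Finset.mem_range,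
    Finset.mem_range] at hq
  -- If t ≤ N := ⌊βH⌋, a missing pair has t + d > H, hence d ≥ H - N + 1.
  omega

end Bias

/-! ### Total variance of the estimator. -/

section Variance

variable {S A : Type*} [Fintype S] [Fintype A] [Nonempty A] [MeasurableSpace S]
  [MeasurableSpace A] [DiscreteMeasurableSpace S] [DiscreteMeasurableSpace A]

theorem reinforceVar_eq (M : FiniteMDP S A) {β : ℝ} (hβ1 : β ≤ 1) (b : S → ℝ) (lam : ℝ)
    (θ : PolicyParam S A) (H : ℕ) :
    M.reinforceVar β b lam θ H =
      ∫ x, ‖M.reinforce β b lam θ H x‖ ^ 2 ∂M.trajLaw (softmaxPolicy θ) -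
      ‖∫ x, M.reinforce β b lam θ H x ∂M.trajLaw (softmaxPolicy θ)‖ ^ 2 := by
  have hadapt := M.reinforce_eq_stopPath hβ1 b lam θ H
  have hi : ∀ i, Integrable (fun x => M.reinforce β b lam θ H x i)
      (M.trajLaw (softmaxPolicy θ)) := fun i =>
    integrable_of_stopPath (n := H) (fun x => by rw [← hadapt]) _
  have hi2 : ∀ i, Integrable (fun x => M.reinforce β b lam θ H x i ^ 2)
      (M.trajLaw (softmaxPolicy θ)) := fun i =>
    integrable_of_stopPath (n := H) (fun x => by rw [← hadapt]) _
  simp only [EuclideanSpace.real_norm_sq_eq]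
  rw [integral_finsetSum _ fun i _ => hi2 i, ← Finset.sum_sub_distrib, reinforceVar]
  refine Finset.sum_congr rfl fun i _ => ?_
  rw [variance_eq_sub ((memLp_two_iff_integrable_sq (hi i).aestronglyMeasurable).2 (hi2 i)),
    eval_integral_piLp hi i]
  rfl

theorem reinforceVar_nonneg (M : FiniteMDP S A) (β : ℝ) (b : S → ℝ) (lam : ℝ)
    (θ : PolicyParam S A) (H : ℕ) : 0 ≤ M.reinforceVar β b lam θ H :=
  Finset.sum_nonneg fun _ _ => variance_nonneg _ _

theorem reinforceVar_le [Nonempty S] (M : FiniteMDP S A) {β : ℝ} (hβ1 : β ≤ 1) {b : S → ℝ}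
    {B : ℝ} (hb : ∀ s, |b s| ≤ B) {lam : ℝ} (hlam : 0 ≤ lam) (θ : PolicyParam S A) (H : ℕ) :
    M.reinforceVar β b lam θ H ≤
      (2 * (1 + B * (1 - M.discount)) / (1 - M.discount) ^ 2 + 2 * lam) ^ 2 := by
  rw [M.reinforceVar_eq hβ1]
  refine (sub_le_self _ (sq_nonneg _)).trans ?_
  refine (integral_mono (integrable_of_stopPath (n := H) (fun x => by
    rw [← M.reinforce_eq_stopPath hβ1]) _) (integrable_const _) fun x =>
      pow_le_pow_left₀ (norm_nonneg _) (M.norm_reinforce_le β hb hlam θ H x) 2).trans_eq (by simp)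

end Variance
end FiniteMDP

/-! ### Powers, logarithms and the sum of squared biases. -/

section Numerics

theorem pow_le_rpow_of_logb_le {γ y : ℝ} (hγ0 : 0 ≤ γ) (hγ1 : γ < 1) (hy : 0 < y) {n : ℕ}
    (hn : n ≠ 0) (h : 2 / 3 * Real.logb (1 / γ) y ≤ n) : γ ^ n ≤ y ^ (-(2 / 3) : ℝ) := by
  -- For γ = 0 the base 1 / γ is 0 and `Real.logb` returns 0, so `h` says nothing. Then `hn` is what
  -- makes γ ^ n vanish.
  rcases hγ0.eq_or_lt with rfl | hγ
  · rw [zero_pow hn]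
    positivity
  · have h1 : 1 < 1 / γ := (one_lt_div hγ).2 hγ1
    calc γ ^ n = γ ^ (n : ℝ) := (Real.rpow_natCast γ n).symm
      _ ≤ γ ^ (2 / 3 * Real.logb (1 / γ) y) := Real.rpow_le_rpow_of_exponent_ge hγ hγ1.le h
      _ = ((1 / γ) ^ Real.logb (1 / γ) y) ^ (-(2 / 3) : ℝ) := by
        rw [← Real.rpow_mul (by positivity), one_div, Real.inv_rpow hγ.le, ← Real.rpow_neg hγ.le]
        congr 1
        ring
      _ = y ^ (-(2 / 3) : ℝ) := by
        rw [Real.rpow_logb (by positivity) h1.ne' hy]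

/-- Explains the 8 and the cube in the horizon condition: 8^(-2/3) = 1/4, and the cube turns into
the square that cancels the 1/(1-γ)² of the bias bound. -/
theorem eight_mul_div_rpow {K δ : ℝ} (hK : 0 < K) (hδ : 0 < δ) :
    (8 * K / δ ^ 3) ^ (-(2 / 3) : ℝ) = K ^ (-(2 / 3) : ℝ) * δ ^ 2 / 4 := by
  have h8 : (8 : ℝ) ^ (-(2 / 3) : ℝ) = 1 / 4 := by
    rw [show (8 : ℝ) = 2 ^ (3 : ℝ) by norm_num, ← Real.rpow_mul (by norm_num),
      show (3 : ℝ) * -(2 / 3) = -2 by norm_num, Real.rpow_neg (by norm_num)]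
    norm_num
  have hd : (δ ^ 3) ^ (-(2 / 3) : ℝ) = (δ ^ 2)⁻¹ := by
    rw [← Real.rpow_natCast, ← Real.rpow_mul hδ.le,
      show ((3 : ℕ) : ℝ) * -(2 / 3) = -((2 : ℕ) : ℝ) by norm_num, Real.rpow_neg hδ.le,
      Real.rpow_natCast]
  rw [Real.div_rpow (by positivity) (by positivity), Real.mul_rpow (by norm_num) hK.le, h8, hd,
    div_inv_eq_mul]
  ring

theorem sum_rpow_neg_two_thirds_sq_le (n : ℕ) :
    ∑ k ∈ Finset.range n, (((k : ℝ) + 1) ^ (-(2 / 3) : ℝ)) ^ 2 ≤ 4 := by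
  -- Telescoping form of the comparison with the integral of x^(-4/3). Equality at n = 0 fixes the
  -- constant 4.
  have key : ∑ k ∈ Finset.range (n + 1), (((k : ℝ) + 1) ^ (-(2 / 3) : ℝ)) ^ 2 ≤
      4 - 3 * (((n : ℝ) + 1) ^ (1 / 3 : ℝ))⁻¹ := by
    induction n with
    | zero => norm_num
    | succ n ih =>
      rw [Finset.sum_range_succ]
      push_cast
      have hcube : ∀ z : ℝ, 0 ≤ z → (z ^ (1 / 3 : ℝ)) ^ 3 = z := fun z hz => by
        rw [← Real.rpow_natCast, ← Real.rpow_mul hz]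
        norm_num
      have hx0 : (0 : ℝ) < (n : ℝ) + 1 := by positivity
      have hy0 : (0 : ℝ) < (n : ℝ) + 1 + 1 := by positivity
      have h43 : (((n : ℝ) + 1 + 1) ^ (-(2 / 3) : ℝ)) ^ 2 =
          ((((n : ℝ) + 1 + 1) ^ (1 / 3 : ℝ)) ^ 4)⁻¹ := by
        rw [← Real.rpow_natCast, ← Real.rpow_natCast, ← Real.rpow_mul hy0.le,
          ← Real.rpow_mul hy0.le, ← Real.rpow_neg hy0.le]
        norm_num
      have hx3 := hcube _ hx0.le
      have hy3 := hcube _ hy0.le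
      have hxy : ((n : ℝ) + 1) ^ (1 / 3 : ℝ) ≤ ((n : ℝ) + 1 + 1) ^ (1 / 3 : ℝ) :=
        Real.rpow_le_rpow hx0.le (by linarith) (by norm_num)
      have hx : 0 < ((n : ℝ) + 1) ^ (1 / 3 : ℝ) := by positivity
      rw [h43]
      generalize ((n : ℝ) + 1) ^ (1 / 3 : ℝ) = x at *
      generalize ((n : ℝ) + 1 + 1) ^ (1 / 3 : ℝ) = y at *
      have hy : 0 < y := hx.trans_le hxy
      -- Here x and y are cube roots of consecutive integers. So 1 ≤ 3(y - x)y², and 3/x - 3/y = 3(y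
      -- - x)/(xy) ≥ 1/(xy³) ≥ 1/y⁴, the new summand.
      have hdiff : (y - x) * (x ^ 2 + x * y + y ^ 2) = 1 := by linear_combination hy3 - hx3
      have h3 : 1 ≤ 3 * (y - x) * y ^ 2 := by
        rw [← hdiff]
        have : x ^ 2 + x * y + y ^ 2 ≤ 3 * y ^ 2 := by nlinarith
        nlinarith [mul_le_mul_of_nonneg_left this (sub_nonneg.2 hxy)]
      have h4 : (y ^ 4)⁻¹ ≤ 3 * x⁻¹ - 3 * y⁻¹ := by
        have e : 3 * x⁻¹ - 3 * y⁻¹ - (y ^ 4)⁻¹ = (3 * (y - x) * y ^ 2 * y - x) / (x * y ^ 4) := by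
          field_simp
        have : 0 ≤ 3 * (y - x) * y ^ 2 * y - x := by nlinarith
        have := div_nonneg this (by positivity : 0 ≤ x * y ^ 4)
        linarith
      linarith
  refine (Finset.sum_le_sum_of_subset_of_nonneg (Finset.range_mono n.le_succ)
    fun _ _ _ => by positivity).trans (key.trans ?_)
  have : (0 : ℝ) ≤ 3 * (((n : ℝ) + 1) ^ (1 / 3 : ℝ))⁻¹ := by positivity
  linarith

end Numerics

/-! ### Consequences of the logarithmic horizon. -/

namespace FiniteMDP

/-- As min β (1 - β) ≤ 1/2, the prefactor 2/(3 min β (1 - β)) exceeds 1, and the argument of the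
logarithm is at least K. -/
theorem logb_le_horizon {S A : Type*} (M : FiniteMDP S A) {β : ℝ} (hβ : β ∈ Set.Ioo (0 : ℝ) 1)
    {H K : ℝ} (hK : 1 ≤ K) (hH : 2 * Real.logb (1 / M.discount) (8 * K / (1 - M.discount) ^ 3) /
      (3 * min β (1 - β)) ≤ H) : Real.logb (1 / M.discount) K ≤ H := by
  have hγ : 0 < 1 - M.discount := sub_pos.2 M.discount_lt_one
  have hm : 0 < min β (1 - β) := lt_min hβ.1 (sub_pos.2 hβ.2)
  have hm2 : min β (1 - β) ≤ 1 / 2 := by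
    rcases le_total β (1 / 2) with h | h
    · exact (min_le_left _ _).trans h
    · exact (min_le_right _ _).trans (by linarith)
  rcases M.discount_nonneg.eq_or_lt with h0 | h0
  · rw [← h0] at hH ⊢
    simpa using hH
  · have h1 : 1 < 1 / M.discount := (one_lt_div h0).2 M.discount_lt_one
    have hle : K ≤ 8 * K / (1 - M.discount) ^ 3 := by
      rw [le_div_iff₀ (by positivity)]
      have : (1 - M.discount) ^ 3 ≤ 1 := pow_le_one₀ hγ.le (by linarith)
      nlinarith
    have hmono := Real.logb_le_logb_of_le h1 (by linarith) hle
    have hnn := Real.logb_nonneg h1 hK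
    refine le_trans ?_ hH
    rw [le_div_iff₀ (by positivity)]
    nlinarith

variable {S A : Type*} [Fintype S] [Fintype A] [Nonempty A] [MeasurableSpace S]
  [MeasurableSpace A] [DiscreteMeasurableSpace S] [DiscreteMeasurableSpace A]

/-- The bias of the REINFORCE estimator for a horizon growing logarithmically in `K`. -/
theorem norm_gradient_sub_integral_reinforce_le_rpow (M : FiniteMDP S A) {β : ℝ}
    (hβ : β ∈ Set.Ioo (0 : ℝ) 1) (b : S → ℝ) (lam : ℝ) (θ : PolicyParam S A) {H : ℕ} {K : ℝ}
    (hK : 0 < K)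
    (hH : 2 * Real.logb (1 / M.discount) (8 * K / (1 - M.discount) ^ 3) /
      (3 * min β (1 - β)) ≤ (H : ℝ)) :
    ‖gradient (M.surrogate lam) θ -
        ∫ x, M.reinforce β b lam θ H x ∂M.trajLaw (softmaxPolicy θ)‖ ≤ K ^ (-(2 / 3) : ℝ) := by
  have hγ : 0 < 1 - M.discount := sub_pos.2 M.discount_lt_one
  have hm : 0 < min β (1 - β) := lt_min hβ.1 (sub_pos.2 hβ.2)
  have hH0 : (0 : ℝ) ≤ H := Nat.cast_nonneg H
  have hlog : 2 / 3 * Real.logb (1 / M.discount) (8 * K / (1 - M.discount) ^ 3) ≤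
      min β (1 - β) * H := by
    rw [div_le_iff₀ (by positivity)] at hH
    linarith
  -- The two truncation exponents are at least βH and (1 - β)H. Their + 1 also keeps them nonzero,
  -- as the case γ = 0 needs.
  have hN1 : min β (1 - β) * H ≤ ((⌊β * (H : ℝ)⌋₊ + 1 : ℕ) : ℝ) := by
    push_cast
    exact (mul_le_mul_of_nonneg_right (min_le_left _ _) hH0).trans (Nat.lt_floor_add_one _).le
  have hN2 : min β (1 - β) * H ≤ ((H - ⌊β * (H : ℝ)⌋₊ + 1 : ℕ) : ℝ) := by
    push_cast [Nat.cast_sub (floor_mul_le hβ.2.le H)]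
    have h1 := mul_le_mul_of_nonneg_right (min_le_right β (1 - β)) hH0
    have h2 := Nat.floor_le (mul_nonneg hβ.1.le hH0)
    linarith
  have hy : 0 < 8 * K / (1 - M.discount) ^ 3 := by positivity
  have h1 := pow_le_rpow_of_logb_le M.discount_nonneg M.discount_lt_one hy (Nat.succ_ne_zero _)
    (hlog.trans hN1)
  have h2 := pow_le_rpow_of_logb_le M.discount_nonneg M.discount_lt_one hy (Nat.succ_ne_zero _)
    (hlog.trans hN2)
  -- Each power is at most K^(-2/3)(1-γ)²/4. The prefactor 2/(1-γ)² applied to their sum gives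
  -- exactly K^(-2/3).
  rw [eight_mul_div_rpow hK hγ] at h1 h2
  refine (M.norm_gradient_sub_integral_reinforce_le hβ.2.le b lam θ H).trans ?_
  rw [div_le_iff₀ (by positivity)]
  simp only [Nat.succ_eq_add_one] at h1 h2
  linarith

end FiniteMDP

/-! ### From the sampling law to conditional expectations. -/

section ConditionalLaw

variable {S A Ω : Type*} [Fintype S] [Fintype A] [MeasurableSpace S] [MeasurableSpace A]
  [DiscreteMeasurableSpace S] [DiscreteMeasurableSpace A]

/-- Horizons are countably many and paths up to a fixed horizon finitely many, so measurability in
the parameter suffices. -/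
theorem measurable_comp_stopPath {Θ E : Type*} [MeasurableSpace Θ] [MeasurableSpace E]
    [MeasurableSpace Ω] {φ : Θ → ℕ → (ℕ → S × A) → E}
    (hadapt : ∀ η h x, φ η h x = φ η h (stopPath h x))
    (hφ : ∀ h x, Measurable fun η => φ η h x)
    {θ : Ω → Θ} {H : Ω → ℕ} {τ : Ω → ℕ → S × A}
    (hθ : Measurable θ) (hH : Measurable H) (hτ : Measurable τ) :
    Measurable fun ω => φ (θ ω) (H ω) (τ ω) := by
  have h1 : ∀ h : ℕ, Measurable fun ω => φ (θ ω) h (τ ω) := fun h => by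
    have hprod : Measurable fun z : (∀ _ : Finset.Iic h, S × A) × Θ =>
        φ z.2 h (extendPath h z.1) :=
      measurable_from_prod_countable_right fun p => hφ h (extendPath h p)
    have := hprod.comp (((Preorder.measurable_frestrictLe
      (X := fun _ : ℕ => S × A) h).comp hτ).prodMk hθ)
    refine (funext fun ω => ?_ : (fun ω => φ (θ ω) h (τ ω)) = _) ▸ this
    rw [hadapt]
    rfl
  have h2 : Measurable fun z : ℕ × Ω => φ (θ z.2) z.1 (τ z.2) :=
    measurable_from_prod_countable_right h1
  exact h2.comp (hH.prodMk measurable_id)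

variable [Nonempty A] [MeasurableSpace Ω] {M : FiniteMDP S A} {μ : Measure Ω}
  {α : ℕ → ℕ → ℝ} {T : ℕ → ℕ} {ε : ℝ} {post : PolicyParam S A → PolicyParam S A}
  {g θ : ℕ → ℕ → Ω → PolicyParam S A} {H : ℕ → ℕ → Ω → ℕ} {τ : ℕ → ℕ → Ω → ℕ → S × A}

namespace IsPhasedPolicyGradient

theorem history_le (hrun : IsPhasedPolicyGradient M μ α T ε post g θ H τ) (l k : ℕ) :
    history T θ H τ l k ≤ ‹MeasurableSpace Ω› := by
  refine sup_le (sup_le (iSup_le fun l' => iSup_le fun k' => iSup_le fun _ =>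
    sup_le (sup_le (hrun.measurable_param l' k').comap_le (hrun.measurable_horizon l' k').comap_le)
      ?_) (hrun.measurable_param l k).comap_le) (hrun.measurable_horizon l k).comap_le
  refine Measurable.comap_le (measurable_pi_lambda _ fun i => ?_)
  exact measurable_comp_stopPath (Θ := Unit) (φ := fun _ h x => stopPath h x i)
    (θ := fun _ => ()) (fun _ h x => by simp [stopPath]) (fun _ _ => measurable_const)
    measurable_const (hrun.measurable_horizon l' k') (hrun.measurable_traj l' k')

/-- Freezing: given the history, parameter and horizon act as constants and the trajectory is
integrated against its law. -/
theorem condExp_history_ae_eq [IsProbabilityMeasure μ]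
    (hrun : IsPhasedPolicyGradient M μ α T ε post g θ H τ) {l k : ℕ} (hk : k < T l)
    {φ : PolicyParam S A → ℕ → (ℕ → S × A) → ℝ}
    (hadapt : ∀ η h x, φ η h x = φ η h (stopPath h x))
    (hφ : ∀ h x, Measurable fun η => φ η h x) {C : ℝ} (hC : ∀ η h x, |φ η h x| ≤ C) :
    μ[fun ω => φ (θ l k ω) (H l k ω) (τ l k ω) | history T θ H τ l k] =ᵐ[μ]
      fun ω => ∫ x, φ (θ l k ω) (H l k ω) x ∂M.trajLaw (softmaxPolicy (θ l k ω)) := by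
  classical
  have hm := hrun.history_le l k
  have hθm : Measurable[history T θ H τ l k] (θ l k) :=
    (comap_measurable (θ l k)).mono (le_sup_of_le_left le_sup_right) le_rfl
  have hHm : Measurable[history T θ H τ l k] (H l k) :=
    (comap_measurable (H l k)).mono le_sup_right le_rfl
  have hf : Measurable fun ω => φ (θ l k ω) (H l k ω) (τ l k ω) :=
    measurable_comp_stopPath hadapt hφ (hrun.measurable_param l k) (hrun.measurable_horizon l k)
      (hrun.measurable_traj l k)
  have hfi : Integrable (fun ω => φ (θ l k ω) (H l k ω) (τ l k ω)) μ :=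
    Integrable.of_bound hf.aestronglyMeasurable C (Filter.Eventually.of_forall fun ω => hC _ _ _)
  have hpathm : Measurable fun ω => stopPath (H l k ω) (τ l k ω) :=
    measurable_pi_lambda _ fun i => measurable_comp_stopPath (Θ := Unit)
      (φ := fun _ h x => stopPath h x i) (θ := fun _ => ())
      (fun _ h x => by simp [stopPath]) (fun _ _ => measurable_const) measurable_const
      (hrun.measurable_horizon l k) (hrun.measurable_traj l k)
  have key : ∀ h : ℕ, ∀ᵐ ω ∂μ, H l k ω = h →
      (μ[fun ω => φ (θ l k ω) (H l k ω) (τ l k ω) | history T θ H τ l k]) ω =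
        ∫ x, φ (θ l k ω) (H l k ω) x ∂M.trajLaw (softmaxPolicy (θ l k ω)) := by
    intro h
    have hs : MeasurableSet[history T θ H τ l k] {ω | H l k ω = h} :=
      hHm (measurableSet_singleton h)
    have hE : ∀ p : (∀ _ : Finset.Iic h, S × A),
        MeasurableSet {ω | stopPath (H l k ω) (τ l k ω) ∈ ({extendPath h p} : Set _)} := fun p =>
      hpathm (measurableSet_singleton _)
    have hc : ∀ p : (∀ _ : Finset.Iic h, S × A), StronglyMeasurable[history T θ H τ l k]
        ({ω | H l k ω = h}.indicator fun ω => φ (θ l k ω) h (extendPath h p)) := fun p =>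
      (((hφ h (extendPath h p)).comp hθm).stronglyMeasurable).indicator hs
    have hind : ∀ p : (∀ _ : Finset.Iic h, S × A), Integrable
        ({ω | stopPath (H l k ω) (τ l k ω) ∈ ({extendPath h p} : Set _)}.indicator
          fun _ => (1 : ℝ)) μ := fun p => (integrable_const 1).indicator (hE p)
    have hmul : ∀ p : (∀ _ : Finset.Iic h, S × A), Integrable
        (({ω | H l k ω = h}.indicator fun ω => φ (θ l k ω) h (extendPath h p)) *
          {ω | stopPath (H l k ω) (τ l k ω) ∈ ({extendPath h p} : Set _)}.indicator
            fun _ => (1 : ℝ)) μ := fun p => by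
      refine (hind p).bdd_mul (c := C) ((hc p).mono hm).aestronglyMeasurable
        (Filter.Eventually.of_forall fun ω => ?_)
      by_cases hω : ω ∈ {ω | H l k ω = h}
      · rw [Set.indicator_of_mem hω]
        exact hC _ _ _
      · rw [Set.indicator_of_notMem hω, norm_zero]
        exact (abs_nonneg _).trans (hC (θ l k ω) h (τ l k ω))
    -- On {H = h} the functional is a finite sum over paths p of a history-measurable coefficient
    -- times the indicator that p was sampled. The coefficient is pulled out and the sampling law
    -- evaluates the indicator.
    have hdecomp : {ω | H l k ω = h}.indicator (fun ω => φ (θ l k ω) (H l k ω) (τ l k ω)) =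
        ∑ p : (∀ _ : Finset.Iic h, S × A),
          ({ω | H l k ω = h}.indicator fun ω => φ (θ l k ω) h (extendPath h p)) *
          {ω | stopPath (H l k ω) (τ l k ω) ∈ ({extendPath h p} : Set _)}.indicator
            fun _ => (1 : ℝ) := by
      funext ω
      rw [Finset.sum_apply]
      by_cases hω : H l k ω = h
      · have hterm : ∀ p : (∀ _ : Finset.Iic h, S × A),
            (({ω | H l k ω = h}.indicator fun ω => φ (θ l k ω) h (extendPath h p)) *
              {ω | stopPath (H l k ω) (τ l k ω) ∈ ({extendPath h p} : Set _)}.indicator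
                fun _ => (1 : ℝ)) ω =
            if Preorder.frestrictLe (π := fun _ => S × A) h (τ l k ω) = p then
              φ (θ l k ω) h (extendPath h p) else 0 := fun p => by
          have hiff := stopPath_eq_extendPath_iff h (τ l k ω) p
          rw [Pi.mul_apply, Set.indicator_of_mem (s := {ω | H l k ω = h}) hω]
          split_ifs with hp
          · rw [Set.indicator_of_mem, mul_one]
            change stopPath (H l k ω) (τ l k ω) = _
            rw [hω, hiff, hp]
          · rw [Set.indicator_of_notMem, mul_zero]
            change ¬stopPath (H l k ω) (τ l k ω) = _
            rwa [hω, hiff]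
        rw [Finset.sum_congr rfl fun p _ => hterm p, Finset.sum_ite_eq,
          if_pos (Finset.mem_univ _), extendPath_frestrictLe, ← hadapt,
          Set.indicator_of_mem (s := {ω | H l k ω = h}) hω, hω]
      · simp [hω]
    have hcond := condExp_indicator hfi hs
    rw [hdecomp] at hcond
    have hsum := condExp_finsetSum (m := history T θ H τ l k)
      (s := (Finset.univ : Finset (∀ _ : Finset.Iic h, S × A))) fun p _ => hmul p
    have hpull := ae_all_iff.2 fun p : (∀ _ : Finset.Iic h, S × A) =>
      condExp_mul_of_stronglyMeasurable_left (m := history T θ H τ l k) (hc p) (hmul p) (hind p)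
    have hlaw := ae_all_iff.2 fun p : (∀ _ : Finset.Iic h, S × A) =>
      hrun.law l k hk {extendPath h p} (measurableSet_singleton _)
    filter_upwards [hcond, hsum, hpull, hlaw] with ω h1 h2 h3 h4 hω
    rw [Set.indicator_of_mem (s := {ω | H l k ω = h}) hω] at h1
    rw [← h1, h2, Finset.sum_apply, FiniteMDP.integral_eq_sum_of_stopPath _ (H l k ω) (hadapt _ _),
      hω]
    refine Finset.sum_congr rfl fun p _ => ?_
    rw [h3, Pi.mul_apply, h4, Set.indicator_of_mem (s := {ω | H l k ω = h}) hω, hω, smul_eq_mul,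
      mul_comm]
    simp only [Set.mem_singleton_iff, stopPath_eq_extendPath_iff]
  filter_upwards [ae_all_iff.2 key] with ω hω
  exact hω _ rfl

/-- Tower property. The conditional mean given the history still depends on H, but the lower bound
depends on θ only and is therefore unchanged by projecting. -/
theorem le_condExp_param [IsProbabilityMeasure μ]
    (hrun : IsPhasedPolicyGradient M μ α T ε post g θ H τ) {l k : ℕ} (hk : k < T l)
    {φ : PolicyParam S A → ℕ → (ℕ → S × A) → ℝ}
    (hadapt : ∀ η h x, φ η h x = φ η h (stopPath h x))
    (hφ : ∀ h x, Measurable fun η => φ η h x) {C : ℝ} (hC : ∀ η h x, |φ η h x| ≤ C)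
    {u : PolicyParam S A → ℝ} (hu : Measurable u) {D : ℝ} (hD : ∀ η, |u η| ≤ D)
    (hle : ∀ᵐ ω ∂μ, u (θ l k ω) ≤
      ∫ x, φ (θ l k ω) (H l k ω) x ∂M.trajLaw (softmaxPolicy (θ l k ω))) :
    ∀ᵐ ω ∂μ, u (θ l k ω) ≤ (μ[fun ω => φ (θ l k ω) (H l k ω) (τ l k ω) |
      MeasurableSpace.comap (θ l k) inferInstance]) ω := by
  have hθ := hrun.measurable_param l k
  have hG := hrun.condExp_history_ae_eq hk hadapt hφ hC
  have hle' : MeasurableSpace.comap (θ l k) inferInstance ≤ history T θ H τ l k :=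
    le_sup_of_le_left le_sup_right
  have htower := condExp_condExp_of_le (μ := μ)
    (f := fun ω => φ (θ l k ω) (H l k ω) (τ l k ω)) hle' (hrun.history_le l k)
  have hui : Integrable (fun ω => u (θ l k ω)) μ :=
    Integrable.of_bound (hu.comp hθ).aestronglyMeasurable D
      (Filter.Eventually.of_forall fun ω => hD _)
  have hmono := condExp_mono (m := MeasurableSpace.comap (θ l k) inferInstance) hui
    (integrable_condExp (μ := μ) (m := history T θ H τ l k)
      (f := fun ω => φ (θ l k ω) (H l k ω) (τ l k ω)))
    (by filter_upwards [hle, hG] with ω h1 h2 using h1.trans_eq h2.symm)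
  have hself : μ[fun ω => u (θ l k ω) | MeasurableSpace.comap (θ l k) inferInstance] =
      fun ω => u (θ l k ω) := condExp_of_stronglyMeasurable hθ.comap_le
    (hu.comp (comap_measurable (θ l k))).stronglyMeasurable hui
  rw [hself] at hmono
  filter_upwards [hmono, htower] with ω h1 h2 using h1.trans_eq h2

theorem condExp_param_le [IsProbabilityMeasure μ]
    (hrun : IsPhasedPolicyGradient M μ α T ε post g θ H τ) {l k : ℕ} (hk : k < T l)
    {φ : PolicyParam S A → ℕ → (ℕ → S × A) → ℝ}
    (hadapt : ∀ η h x, φ η h x = φ η h (stopPath h x))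
    (hφ : ∀ h x, Measurable fun η => φ η h x) {C : ℝ} (hC : ∀ η h x, |φ η h x| ≤ C)
    {u : PolicyParam S A → ℝ} (hu : Measurable u) {D : ℝ} (hD : ∀ η, |u η| ≤ D)
    (hle : ∀ᵐ ω ∂μ, ∫ x, φ (θ l k ω) (H l k ω) x ∂M.trajLaw (softmaxPolicy (θ l k ω)) ≤
      u (θ l k ω)) :
    ∀ᵐ ω ∂μ, (μ[fun ω => φ (θ l k ω) (H l k ω) (τ l k ω) |
      MeasurableSpace.comap (θ l k) inferInstance]) ω ≤ u (θ l k ω) := by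
  have h := hrun.le_condExp_param hk (φ := fun η h x => -φ η h x) (u := fun η => -u η)
    (fun η h x => by rw [← hadapt]) (fun h x => (hφ h x).neg)
    (fun η h x => by rw [abs_neg]; exact hC η h x) hu.neg
    (fun η => by rw [abs_neg]; exact hD η)
    (by filter_upwards [hle] with ω hω; rw [integral_neg]; exact neg_le_neg hω)
  have hneg := condExp_neg (μ := μ) (fun ω => φ (θ l k ω) (H l k ω) (τ l k ω))
    (MeasurableSpace.comap (θ l k) inferInstance)
  filter_upwards [h, hneg] with ω h1 h2
  have h3 : -u (θ l k ω) ≤ _ := h1.trans_eq h2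
  exact neg_le_neg_iff.1 h3

end IsPhasedPolicyGradient
end ConditionalLaw

/-! ### Regularity in the parameter, the variance supremum and the second moment. -/

namespace FiniteMDP

variable {S A : Type*}

theorem nonempty_state (M : FiniteMDP S A) : Nonempty S :=
  let ⟨s, _⟩ := M.initial.support_nonempty
  ⟨s⟩

variable [Fintype S] [Fintype A] [Nonempty A]

theorem continuous_reinforce (M : FiniteMDP S A) (β : ℝ) (b : S → ℝ) (lam : ℝ) (H : ℕ)
    (x : ℕ → S × A) : Continuous fun θ : PolicyParam S A => M.reinforce β b lam θ H x := by
  have := fun s a => continuous_score (S := S) (A := A) s a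
  unfold reinforce
  fun_prop

variable [MeasurableSpace S] [MeasurableSpace A] [DiscreteMeasurableSpace S]
  [DiscreteMeasurableSpace A]

theorem measurable_gradient_surrogate (M : FiniteMDP S A) (lam : ℝ) :
    Measurable (gradient (M.surrogate lam)) :=
  (InnerProductSpace.toDual ℝ (PolicyParam S A)).symm.continuous.measurable.comp
    (measurable_fderiv ℝ (M.surrogate lam))

theorem isLUB_reinforceVarSet (M : FiniteMDP S A) {β : ℝ} (hβ1 : β ≤ 1) {b : S → ℝ} {B : ℝ}
    (hB : 0 ≤ B) (hb : ∀ s, |b s| ≤ B) {lamBar : ℝ} (hlamBar : 0 ≤ lamBar) :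
    IsLUB (M.reinforceVarSet β b lamBar) (M.reinforceVarBound β b lamBar) ∧
    M.reinforceVarBound β b lamBar ∈
      Set.Icc 0 (4 * ((1 + B * (1 - M.discount)) / (1 - M.discount) ^ 2 + lamBar) ^ 2) := by
  have := M.nonempty_state
  have hγ : 0 < 1 - M.discount := sub_pos.2 M.discount_lt_one
  -- One explicit member makes the set nonempty, as `sSup` requires, and being a variance it also
  -- yields the lower bound 0.
  have hmem : M.reinforceVar β b 0 (0 : PolicyParam S A) 0 ∈ M.reinforceVarSet β b lamBar :=
    ⟨0, 0, 0, ⟨le_rfl, hlamBar⟩, rfl⟩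
  have hub : 4 * ((1 + B * (1 - M.discount)) / (1 - M.discount) ^ 2 + lamBar) ^ 2 ∈
      upperBounds (M.reinforceVarSet β b lamBar) := by
    rintro v ⟨H, θ, lam, hlam, rfl⟩
    refine (M.reinforceVar_le hβ1 hb hlam.1 θ H).trans ?_
    have h0 : 0 ≤ (1 + B * (1 - M.discount)) / (1 - M.discount) ^ 2 := by positivity
    rw [mul_div_assoc, ← mul_add, mul_pow]
    have := pow_le_pow_left₀ (add_nonneg h0 hlam.1)
      (add_le_add_right hlam.2 ((1 + B * (1 - M.discount)) / (1 - M.discount) ^ 2)) 2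
    linarith
  have hlub := isLUB_csSup ⟨_, hmem⟩ ⟨_, hub⟩
  exact ⟨hlub, (M.reinforceVar_nonneg β b 0 0 0).trans (hlub.1 hmem), hlub.2 hub⟩

/-- Second moment of the REINFORCE estimator in terms of variance, bias and exact gradient. -/
theorem integral_norm_reinforce_sq_le (M : FiniteMDP S A) {β : ℝ} (hβ1 : β ≤ 1) (b : S → ℝ)
    (lam : ℝ) (θ : PolicyParam S A) (H : ℕ) {e : ℝ}
    (he : ‖gradient (M.surrogate lam) θ -
      ∫ x, M.reinforce β b lam θ H x ∂M.trajLaw (softmaxPolicy θ)‖ ≤ e) :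
    ∫ x, ‖M.reinforce β b lam θ H x‖ ^ 2 ∂M.trajLaw (softmaxPolicy θ) ≤
      M.reinforceVar β b lam θ H + 2 * e ^ 2 + 2 * ‖gradient (M.surrogate lam) θ‖ ^ 2 := by
  have hvar := M.reinforceVar_eq hβ1 b lam θ H
  have hn : ‖∫ x, M.reinforce β b lam θ H x ∂M.trajLaw (softmaxPolicy θ)‖ ≤
      ‖gradient (M.surrogate lam) θ‖ + e := by
    have := norm_sub_norm_le (∫ x, M.reinforce β b lam θ H x ∂M.trajLaw (softmaxPolicy θ))
      (gradient (M.surrogate lam) θ)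
    rw [norm_sub_rev] at this
    linarith
  have hsq := pow_le_pow_left₀ (norm_nonneg _) hn 2
  -- (a + e)² ≤ 2a² + 2e² with a the gradient norm; this is the origin of M₂ = 2.
  nlinarith [sq_nonneg (‖gradient (M.surrogate lam) θ‖ - e)]

end FiniteMDP

/-! ### Conditional moments along the algorithm. -/

namespace IsPhasedPolicyGradient

variable {S A Ω : Type*} [Fintype S] [Fintype A] [Nonempty A] [MeasurableSpace S]
  [MeasurableSpace A] [DiscreteMeasurableSpace S] [DiscreteMeasurableSpace A]
  [MeasurableSpace Ω] {μ : Measure Ω} [IsProbabilityMeasure μ] {M : FiniteMDP S A}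
  {α : ℕ → ℕ → ℝ} {T : ℕ → ℕ} {ε : ℝ} {post : PolicyParam S A → PolicyParam S A} {β : ℝ}
  {lam : ℕ → ℝ} {b : S → ℝ} {B : ℝ} {g θ : ℕ → ℕ → Ω → PolicyParam S A} {H : ℕ → ℕ → Ω → ℕ}
  {τ : ℕ → ℕ → Ω → ℕ → S × A}

theorem integrable_estimator (hrun : IsPhasedPolicyGradient M μ α T ε post g θ H τ)
    (hβ1 : β ≤ 1) (hb : ∀ s, |b s| ≤ B) {l k : ℕ} (hlam : 0 ≤ lam l)
    (hg : ∀ ω, g l k ω = M.reinforce β b (lam l) (θ l k ω) (H l k ω) (τ l k ω)) :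
    Integrable (g l k) μ := by
  have := M.nonempty_state
  have hm : Measurable (g l k) := (funext hg) ▸ measurable_comp_stopPath
    (fun η h x => M.reinforce_eq_stopPath hβ1 b (lam l) η h x)
    (fun h x => (M.continuous_reinforce β b (lam l) h x).measurable)
    (hrun.measurable_param l k) (hrun.measurable_horizon l k) (hrun.measurable_traj l k)
  exact Integrable.of_bound hm.aestronglyMeasurable _ (Filter.Eventually.of_forall fun ω =>
    (congrArg norm (hg ω)).trans_le (M.norm_reinforce_le β hb hlam _ _ _))

theorem nearly_unbiased (hrun : IsPhasedPolicyGradient M μ α T ε post g θ H τ)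
    (hβ : β ∈ Set.Ioo (0 : ℝ) 1) (hb : ∀ s, |b s| ≤ B) {l k : ℕ} (hk : k < T l)
    (hlam : 0 ≤ lam l)
    (hg : ∀ ω, g l k ω = M.reinforce β b (lam l) (θ l k ω) (H l k ω) (τ l k ω))
    {e : ℝ} (he0 : 0 ≤ e)
    (he : ∀ᵐ ω ∂μ, ‖gradient (M.surrogate (lam l)) (θ l k ω) - ∫ x, M.reinforce β b (lam l)
      (θ l k ω) (H l k ω) x ∂M.trajLaw (softmaxPolicy (θ l k ω))‖ ≤ e) :
    ∀ᵐ ω ∂μ, ‖gradient (M.surrogate (lam l)) (θ l k ω)‖ ^ 2 -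
        (2 / (1 - M.discount) ^ 2 + 2 * lam l) * e ≤
      inner ℝ (gradient (M.surrogate (lam l)) (θ l k ω))
        ((μ[g l k | MeasurableSpace.comap (θ l k) inferInstance]) ω) := by
  have := M.nonempty_state
  have hγ : 0 < 1 - M.discount := sub_pos.2 M.discount_lt_one
  have hgi := hrun.integrable_estimator hβ.2.le hb hlam hg
  have hgrad := M.measurable_gradient_surrogate (lam l)
  have hG := fun η => M.norm_gradient_surrogate_le hlam η
  set G := 2 / (1 - M.discount) ^ 2 + 2 * lam l with hGdef
  have hG0 : 0 ≤ G := by positivity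
  have hR := fun η h x => M.norm_reinforce_le β hb hlam η h x
  set R := 2 * (1 + B * (1 - M.discount)) / (1 - M.discount) ^ 2 + 2 * lam l with hRdef
  have hbound : ∀ η h x, |inner ℝ (gradient (M.surrogate (lam l)) η)
      (M.reinforce β b (lam l) η h x)| ≤ G * R := fun η h x =>
    (abs_real_inner_le_norm _ _).trans
      (mul_le_mul (hG η) (hR η h x) (norm_nonneg _) hG0)
  have hadapt := fun η h x => M.reinforce_eq_stopPath hβ.2.le b (lam l) η h x
  have hfg : (fun ω => inner ℝ (gradient (M.surrogate (lam l)) (θ l k ω)) (g l k ω)) =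
      fun ω => inner ℝ (gradient (M.surrogate (lam l)) (θ l k ω))
        (M.reinforce β b (lam l) (θ l k ω) (H l k ω) (τ l k ω)) :=
    funext fun ω => by rw [hg]
  -- With m the frozen mean, ⟨∇L, m⟩ = ‖∇L‖² - ⟨∇L, ∇L - m⟩ ≥ ‖∇L‖² - G e by Cauchy–Schwarz.
  have hlow := hrun.le_condExp_param hk
    (φ := fun η h x => inner ℝ (gradient (M.surrogate (lam l)) η) (M.reinforce β b (lam l) η h x))
    (fun η h x => by rw [← hadapt])
    (fun h x => hgrad.inner (M.continuous_reinforce β b (lam l) h x).measurable) hbound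
    (u := fun η => ‖gradient (M.surrogate (lam l)) η‖ ^ 2 - G * e)
    ((hgrad.norm.pow_const 2).sub_const _) (D := G ^ 2 + G * e)
    (fun η => by
      have h1 := pow_le_pow_left₀ (norm_nonneg _) (hG η) 2
      have h2 := mul_nonneg hG0 he0
      rw [abs_le]
      constructor <;> nlinarith [sq_nonneg ‖gradient (M.surrogate (lam l)) η‖])
    (by
      filter_upwards [he] with ω hω
      rw [integral_inner (FiniteMDP.integrable_of_stopPath (hadapt _ _) _)]
      have h1 := real_inner_le_norm (gradient (M.surrogate (lam l)) (θ l k ω))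
        (gradient (M.surrogate (lam l)) (θ l k ω) - ∫ x, M.reinforce β b (lam l)
          (θ l k ω) (H l k ω) x ∂M.trajLaw (softmaxPolicy (θ l k ω)))
      rw [inner_sub_right, real_inner_self_eq_norm_sq] at h1
      have h2 := mul_le_mul (hG (θ l k ω)) hω (norm_nonneg _) hG0
      linarith)
  -- The gradient at θ is measurable with respect to θ, so it leaves the conditional expectation of
  -- the inner product.
  have hpull := condExp_bilin_of_stronglyMeasurable_left (μ := μ)
    (m := MeasurableSpace.comap (θ l k) inferInstance) (innerSL ℝ)
    (hgrad.comp (comap_measurable (θ l k))).stronglyMeasurable (g := g l k) (by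
      refine Integrable.of_bound (C := G * R) ?_ (Filter.Eventually.of_forall fun ω => ?_)
      · exact (((hgrad.comp (hrun.measurable_param l k)).aestronglyMeasurable).inner
          hgi.aestronglyMeasurable)
      · have := hbound (θ l k ω) (H l k ω) (τ l k ω)
        rw [← hg] at this
        exact this) hgi
  filter_upwards [hlow, hpull] with ω h1 h2
  refine (h1.trans_eq ?_).trans_eq h2
  rw [← hfg]
  rfl

theorem second_moment_le (hrun : IsPhasedPolicyGradient M μ α T ε post g θ H τ)
    (hβ1 : β ≤ 1) (hb : ∀ s, |b s| ≤ B) {l k : ℕ} (hk : k < T l)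
    (hlam : 0 ≤ lam l)
    (hg : ∀ ω, g l k ω = M.reinforce β b (lam l) (θ l k ω) (H l k ω) (τ l k ω))
    {e V : ℝ} (hV : ∀ η h, M.reinforceVar β b (lam l) η h ≤ V)
    (he : ∀ᵐ ω ∂μ, ‖gradient (M.surrogate (lam l)) (θ l k ω) - ∫ x, M.reinforce β b (lam l)
      (θ l k ω) (H l k ω) x ∂M.trajLaw (softmaxPolicy (θ l k ω))‖ ≤ e) :
    ∀ᵐ ω ∂μ, (μ[fun ω' => ‖g l k ω'‖ ^ 2 | MeasurableSpace.comap (θ l k) inferInstance]) ω ≤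
      V + 2 * e ^ 2 + 2 * ‖gradient (M.surrogate (lam l)) (θ l k ω)‖ ^ 2 := by
  have := M.nonempty_state
  have hadapt := fun η h x => M.reinforce_eq_stopPath hβ1 b (lam l) η h x
  have hgrad := M.measurable_gradient_surrogate (lam l)
  have hV0 : 0 ≤ V := (M.reinforceVar_nonneg β b (lam l) 0 0).trans (hV 0 0)
  have h := hrun.condExp_param_le hk
    (φ := fun η h x => ‖M.reinforce β b (lam l) η h x‖ ^ 2)
    (fun η h x => by rw [← hadapt])
    (fun h x => (M.continuous_reinforce β b (lam l) h x).measurable.norm.pow_const 2)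
    (fun η h x => by
      rw [abs_of_nonneg (sq_nonneg _)]
      exact pow_le_pow_left₀ (norm_nonneg _) (M.norm_reinforce_le β hb hlam η h x) 2)
    (u := fun η => V + 2 * e ^ 2 + 2 * ‖gradient (M.surrogate (lam l)) η‖ ^ 2)
    (((hgrad.norm.pow_const 2).const_mul 2).const_add _)
    (D := V + 2 * e ^ 2 + 2 * (2 / (1 - M.discount) ^ 2 + 2 * lam l) ^ 2)
    (fun η => by
      rw [abs_of_nonneg (by positivity)]
      have := pow_le_pow_left₀ (norm_nonneg _) (M.norm_gradient_surrogate_le hlam η) 2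
      linarith)
    (by
      filter_upwards [he] with ω hω
      refine (M.integral_norm_reinforce_sq_le hβ1 b _ _ _ hω).trans ?_
      have := hV (θ l k ω) (H l k ω)
      linarith)
  simpa only [hg] using h

end IsPhasedPolicyGradient

/-! ### Assembly of the constants. -/

theorem mainTheorem5
    {S A Ω : Type*} [Fintype S] [Fintype A] [Nonempty A]
    [MeasurableSpace S] [DiscreteMeasurableSpace S]
    [MeasurableSpace A] [DiscreteMeasurableSpace A]
    [MeasurableSpace Ω] (μ : Measure Ω) [IsProbabilityMeasure μ]
    (M : FiniteMDP S A)
    (α : ℕ → ℕ → ℝ) (T : ℕ → ℕ) (hT : ∀ l, 0 < T l)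
    (ε : ℝ) (post : PolicyParam S A → PolicyParam S A)
    (β : ℝ) (hβ : β ∈ Set.Ioo (0 : ℝ) 1)
    (lam : ℕ → ℝ) (lamBar : ℝ) (hlam_nonneg : ∀ l, 0 ≤ lam l) (hlam : ∀ l, lam l ≤ lamBar)
    (B : ℝ) (hB : 0 < B) (b : S → ℝ) (hb : ∀ s, |b s| ≤ B)
    (g θ : ℕ → ℕ → Ω → PolicyParam S A) (H : ℕ → ℕ → Ω → ℕ) (τ : ℕ → ℕ → Ω → ℕ → S × A)
    (hg : ∀ l k, k < T l → ∀ ω,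
      g l k ω = M.reinforce β b (lam l) (θ l k ω) (H l k ω) (τ l k ω))
    (hrun : IsPhasedPolicyGradient M μ α T ε post g θ H τ)
    (hH : ∀ l k, k < T l → ∀ᵐ ω ∂μ,
      2 * Real.logb (1 / M.discount) (8 * ((k : ℝ) + 1) / (1 - M.discount) ^ 3) /
        (3 * min β (1 - β)) ≤ (H l k ω : ℝ)) :
    IsLUB (M.reinforceVarSet β b lamBar) (M.reinforceVarBound β b lamBar) ∧
    M.reinforceVarBound β b lamBar ∈
      Set.Icc 0 (4 * ((1 + B * (1 - M.discount)) / (1 - M.discount) ^ 2 + lamBar) ^ 2) ∧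
    PolicyGradientEstimatorCondition M μ lam T g θ H
      (16 * (1 / (1 - M.discount) ^ 2 + lamBar) ^ 2)
      (2 * (1 + B * (1 - M.discount)) / (1 - M.discount) ^ 2 + 2 * lamBar)
      1
      (32 / (1 - M.discount) ^ 4 + M.reinforceVarBound β b lamBar)
      2
      (fun _ k => (2 / (1 - M.discount) ^ 2 + 2 * lamBar) * ((k : ℝ) + 1) ^ (-(2 / 3) : ℝ)) := by

  have := M.nonempty_state
  have hγ : 0 < 1 - M.discount := sub_pos.2 M.discount_lt_one
  have hlamBar : 0 ≤ lamBar := (hlam_nonneg 0).trans (hlam 0)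
  obtain ⟨hlub, hmem⟩ := M.isLUB_reinforceVarSet hβ.2.le hB.le hb hlamBar
  refine ⟨hlub, hmem, ?_⟩
  have hbound : ∀ l k, k < T l → ∀ ω, ‖g l k ω‖ ≤
      2 * (1 + B * (1 - M.discount)) / (1 - M.discount) ^ 2 + 2 * lamBar := fun l k hk ω => by
    rw [hg l k hk ω]
    refine (M.norm_reinforce_le β hb (hlam_nonneg l) _ _ _).trans ?_
    have := hlam l
    linarith
  have hbias : ∀ l k, k < T l → ∀ᵐ ω ∂μ,
      ‖gradient (M.surrogate (lam l)) (θ l k ω) - ∫ x, M.reinforce β b (lam l)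
        (θ l k ω) (H l k ω) x ∂M.trajLaw (softmaxPolicy (θ l k ω))‖ ≤
      ((k : ℝ) + 1) ^ (-(2 / 3) : ℝ) := fun l k hk => by
    filter_upwards [hH l k hk] with ω hω
    exact M.norm_gradient_sub_integral_reinforce_le_rpow hβ b (lam l) _ (by positivity) hω
  refine
    { pos_C := by positivity
      pos_C₁ := by positivity
      pos_C₂ := one_pos
      pos_M₁ := add_pos_of_pos_of_nonneg (by positivity) hmem.1
      pos_M₂ := two_pos
      differentiable := fun l η => (M.hasGradientAt_surrogate (lam l) η).differentiableAt
      integrable := fun l k hk =>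
        hrun.integrable_estimator hβ.2.le hb (hlam_nonneg l) (hg l k hk)
      integrable_sq := fun l k hk => ?_
      bounded := fun l k hk => Filter.Eventually.of_forall (hbound l k hk)
      nearly_unbiased := fun l k hk => ?_
      second_moment := fun l k hk => ?_
      sum_sq_bias := fun l => ?_
      horizon := fun l k hk => ?_ }
  · have hgi := hrun.integrable_estimator hβ.2.le hb (hlam_nonneg l) (hg l k hk)
    refine Integrable.of_bound (hgi.aestronglyMeasurable.norm.pow 2)
      ((2 * (1 + B * (1 - M.discount)) / (1 - M.discount) ^ 2 + 2 * lamBar) ^ 2)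
      (Filter.Eventually.of_forall fun ω => ?_)
    rw [norm_pow, norm_norm]
    exact pow_le_pow_left₀ (norm_nonneg _) (hbound l k hk ω) 2
  · filter_upwards [hrun.nearly_unbiased hβ hb hk (hlam_nonneg l) (hg l k hk) (by positivity)
      (hbias l k hk)] with ω hω
    refine le_trans ?_ hω
    rw [one_mul]
    refine sub_le_sub_left (mul_le_mul_of_nonneg_right ?_ (by positivity)) _
    have := hlam l
    linarith
  · filter_upwards [hrun.second_moment_le hβ.2.le hb hk (hlam_nonneg l) (hg l k hk)
      (fun η h => hlub.1 ⟨h, η, lam l, ⟨hlam_nonneg l, hlam l⟩, rfl⟩) (hbias l k hk)] with ω hω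
    refine hω.trans ?_
    have h1 : ((k : ℝ) + 1) ^ (-(2 / 3) : ℝ) ≤ 1 :=
      Real.rpow_le_one_of_one_le_of_nonpos (by linarith [Nat.cast_nonneg (α := ℝ) k])
        (by norm_num)
    have h2 : (((k : ℝ) + 1) ^ (-(2 / 3) : ℝ)) ^ 2 ≤ 1 := pow_le_one₀ (by positivity) h1
    -- The squared-bias contribution is at most 2, so this part of M₁ absorbs it with room to spare.
    have h3 : 32 ≤ 32 / (1 - M.discount) ^ 4 := by
      rw [le_div_iff₀ (by positivity)]
      have : (1 - M.discount) ^ 4 ≤ 1 := pow_le_one₀ hγ.le (by linarith [M.discount_nonneg])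
      linarith
    linarith
  -- The factor 4 from the series times (2/(1-γ)² + 2λ̄)² is exactly C.
  · simp only [mul_pow]
    rw [← Finset.mul_sum]
    refine (mul_le_mul_of_nonneg_left (sum_rpow_neg_two_thirds_sq_le (T l))
      (by positivity)).trans_eq ?_
    ring
  · filter_upwards [hH l k hk] with ω hω
    exact M.logb_le_horizon hβ (by linarith [Nat.cast_nonneg (α := ℝ) k]) hω
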